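/- **Large-$N$ Ryu–Takayanagi formula.** *Setup.* Let $\Lambda$ be a partially ordered set. A *code subspace renormalization scheme* on a Hilbert space $\mathcal H$ consists of: a von Neumann factor $M\subset\mathcal B(\mathcal H)$ with a cyclic and separating unit vector $\Omega$ (so $\mathcal H$ is the GNS space of the faithful normal state $\omega=\langle\Omega,\cdot\,\Omega\rangle$); type I subfactors $M_\lambda\subset M$ ($\lambda\in\Lambda$), with $M_\mu\subset M_\lambda$ for $\mu\le\lambda$; faithful normal conditional expectations $\mathcal E_\lambda:M\to M_\lambda$ and $E_{\lambda\mu}:M_\lambda\to M_\mu$ ($\mu\le\lambda$) with $\mathcal E_\mu=E_{\lambda\mu}\circ\mathcal E_\lambda$, $E_{\lambda\nu}=E_{\mu\nu}\circ E_{\lambda\mu}$ and $\omega\circ\mathcal E_\lambda=\omega$. The regulated code subspace is $\mathcal H_\lambda=\overline{M_\lambda\Omega}$; $M_\lambda^L$ is $M_\lambda$ acting on $\mathcal H_\lambda$, and $M_\lambda^R$ is its commutant in $\mathcal B(\mathcal H_\lambda)$. For each $N\in\mathbb N$ let a scheme indexed by $\Lambda$ be given (it may depend on $N$, which is suppressed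 in the notation), together with a finite-dimensional Hilbert space $\mathcal H_N$ of dimension $d_N$ and a contraction $V_N:\mathcal H\to\mathcal H_N^L\otimes\mathcal H_N^R$, where $\mathcal H_N^L=\mathcal H_N^R=\mathcal H_N$. *Entropies.* For a vector $v\in\mathcal A\otimes\mathcal B$ (finite-dimensional, $v$ not necessarily normalized), $S(v,\mathcal B(\mathcal A))=-\mathrm{Tr}(\rho\log\rho)$ with $\rho=\mathrm{Tr}_{\mathcal B}|v\rangle\langle v|$. If $\dim M_\lambda=d_\lambda^2<\infty$, there is a unitary identification $\mathcal H_\lambda\cong\mathcal H_\lambda^L\otimes\mathcal H_\lambda^R$ with $\mathcal H_\lambda^L=\mathcal H_\lambda^R=\mathbb C^{d_\lambda}$ and $M_\lambda^L=\mathcal B(\mathcal H_\lambda^L)\otimes 1$; for any such identification put $S(\Psi,M_\lambda^L)=S(\Psi,\mathcal B(\mathcal H_\lambda^L))$ and $$A(\mathcal H_{L,\lambda})=S\big(|CJ\rangle,\mathcal B(\mathcal H_N^L)\otimes\mathcal B(\mathcal K_L^{ref})\big),\qquad |CJ\rangle=(V_N|_{\mathcal H_\lambda}\otimes \mathrm{Id})|MAX\rangle,$$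 where $\mathcal K_L^{ref},\mathcal K_R^{ref}$ are the duals of $\mathcal H_\lambda^L,\mathcal H_\lambda^R$ and $|MAX\rangle=\frac1{d_\lambda}\sum_{i,j}e_i\otimes e_j\otimes e_i^*\otimes e_j^*$ is the canonical maximally entangled unit vector. *Theorem.* Suppose that for some $\lambda$ the algebra $M_\lambda$ is finite-dimensional of dimension $d_\lambda^2$ independent of $N$, and that $\log d_N\le P(N)$ for all $N$ and some polynomial $P$. Let $\Psi\in\mathcal H_\lambda$ be a unit vector (depending on $N$ if the scheme does) with $\|V_N\Psi\|\to1$ as $N\to\infty$. Let $(\delta_N)$ decay faster than any polynomial in $N$, and suppose that for every $N$ and all unitaries $\hat U^L\in M_\lambda^L$, $\hat U^R\in M_\lambda^R$ there are Borel measurable maps $U^L\mapsto\tilde U^L$ and $U^R\mapsto\tilde U^R$ from the unitary groups of $M_\lambda^L$ and $M_\lambda^R$ to the unitary groups of $\mathcal B(\mathcal H_N^L)$ and $\mathcal B(\mathcal H_N^R)$ such that, for all unitaries $U^L\in M^L_\lambda$, $U^R\in M^R_\lambda$, $$\|V_NU^RU^L\Psi-\tilde U^R\tilde U^LV_N\hat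 U^R\hat U^L\Psi\|\le\delta_N.$$ Then an identification $\mathcal H_\lambda\cong\mathcal H_\lambda^L\otimes\mathcal H_\lambda^R$ as above exists for each $N$, and for every choice of such identifications and all unitaries $\hat U^L\in M_\lambda^L$, $\hat U^R\in M_\lambda^R$ (chosen for each $N$ if the scheme depends on $N$), $$\big|S(\Psi,M_\lambda^L)+A(\mathcal H_{L,\lambda})-S(V_N\hat U^R\hat U^L\Psi,\mathcal B(\mathcal H_N^L))\big|\xrightarrow[N\to\infty]{}0 .$$ -/

import Mathlib

open Filter Topology
open scoped TensorProduct

noncomputable section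

/-! ### Entropy of vectors in tensor products of finite-dimensional Hilbert spaces -/

section Entropy

variable {A B : Type*}
  [NormedAddCommGroup A] [InnerProductSpace ℂ A]
  [NormedAddCommGroup B] [InnerProductSpace ℂ B]

/-- The partial inner product `id ⊗ ⟨b, ·⟩ : A ⊗ B → A`. -/
def partialInner (b : B) : A ⊗[ℂ] B →ₗ[ℂ] A :=
  (TensorProduct.rid ℂ A).toLinearMap ∘ₗ LinearMap.lTensor A (innerₛₗ ℂ b)

/-- The reduced density operator on `A` of a vector `v : A ⊗ B`, that is the partial trace over `B`
of `|v⟩⟨v|`. It is not renormalized: its trace is `‖v‖ ^ 2`. -/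
def reducedDensity [FiniteDimensional ℂ B] (v : A ⊗[ℂ] B) : A →ₗ[ℂ] A :=
  ∑ i, (InnerProductSpace.rankOne ℂ (partialInner (stdOrthonormalBasis ℂ B i) v)
    (partialInner (stdOrthonormalBasis ℂ B i) v) : A →L[ℂ] A).toLinearMap

theorem reducedDensity_isSymmetric [FiniteDimensional ℂ B] (v : A ⊗[ℂ] B) :
    (reducedDensity v).IsSymmetric := by
  intro x y
  simp only [reducedDensity, LinearMap.sum_apply, sum_inner, inner_sum]
  refine Finset.sum_congr rfl fun i _ => ?_
  simp [InnerProductSpace.rankOne_apply, inner_smul_left, inner_smul_right, mul_comm]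

/-- The von Neumann entropy `-Tr (ρ log ρ)` of a self-adjoint operator `ρ`
(used for subnormalized density operators), with `0 log 0 = 0`. -/
def vonNeumannEntropy [FiniteDimensional ℂ A] (ρ : A →ₗ[ℂ] A) (hρ : ρ.IsSymmetric) : ℝ :=
  ∑ i, Real.negMulLog (hρ.eigenvalues rfl i)

/-- `S(v, B(A))`, the entropy of the restriction to `B(A) ⊗ 1` of the (possibly subnormalized)
vector state given by `v : A ⊗ B`. -/
def leftEntropy [FiniteDimensional ℂ A] [FiniteDimensional ℂ B] (v : A ⊗[ℂ] B) : ℝ :=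
  vonNeumannEntropy (reducedDensity v) (reducedDensity_isSymmetric v)

end Entropy

/-! ### Choi–Jamiołkowski state and area term -/

section Area

/-- The canonical maximally entangled unit vector of `(K_L ⊗ K_R) ⊗ (K_L^ref ⊗ K_R^ref)`, where
`K_L = ℂ^m`, `K_R = ℂ^n`, and the reference spaces are the duals of `K_L`, `K_R`, written in the
dual bases. -/
def maxEntangled (m n : Type*) [Fintype m] [Fintype n] :
    (EuclideanSpace ℂ m ⊗[ℂ] EuclideanSpace ℂ n) ⊗[ℂ]
      (EuclideanSpace ℂ m ⊗[ℂ] EuclideanSpace ℂ n) :=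
  (((Real.sqrt (Fintype.card m * Fintype.card n))⁻¹ : ℝ) : ℂ) •
    ∑ i : m, ∑ j : n,
      (EuclideanSpace.basisFun m ℂ i ⊗ₜ[ℂ] EuclideanSpace.basisFun n ℂ j) ⊗ₜ[ℂ]
        (EuclideanSpace.basisFun m ℂ i ⊗ₜ[ℂ] EuclideanSpace.basisFun n ℂ j)

variable {m n : Type*} [Fintype m] [Fintype n] {HL HR : Type*}
  [NormedAddCommGroup HL] [InnerProductSpace ℂ HL]
  [NormedAddCommGroup HR] [InnerProductSpace ℂ HR]

/-- The Choi–Jamiołkowski vector `(V ⊗ Id) |MAX⟩`. -/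
def choiState (V : EuclideanSpace ℂ m ⊗[ℂ] EuclideanSpace ℂ n →ₗ[ℂ] HL ⊗[ℂ] HR) :
    (HL ⊗[ℂ] HR) ⊗[ℂ] (EuclideanSpace ℂ m ⊗[ℂ] EuclideanSpace ℂ n) :=
  LinearMap.rTensor (EuclideanSpace ℂ m ⊗[ℂ] EuclideanSpace ℂ n) V (maxEntangled m n)

/-- The area term `A(K_L) = S(|CJ⟩, B(H_L) ⊗ B(K_L^ref))` of the code `V`. The four tensor factors
are regrouped as `(H_L ⊗ K_L^ref) ⊗ (H_R ⊗ K_R^ref)`. -/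
def areaTerm [FiniteDimensional ℂ HL] [FiniteDimensional ℂ HR]
    (V : EuclideanSpace ℂ m ⊗[ℂ] EuclideanSpace ℂ n →ₗ[ℂ] HL ⊗[ℂ] HR) : ℝ :=
  leftEntropy (TensorProduct.tensorTensorTensorComm ℂ HL HR
    (EuclideanSpace ℂ m) (EuclideanSpace ℂ n) (choiState V))

end Area

/-! ### Code subspace renormalization schemes -/

section Scheme

variable {H : Type*} [NormedAddCommGroup H] [InnerProductSpace ℂ H] [CompleteSpace H]

/-- A factor: a von Neumann algebra with trivial center. -/
def IsFactor (M : VonNeumannAlgebra H) : Prop :=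
  ∀ z ∈ M, z ∈ M.commutant → ∃ c : ℂ, z = c • (1 : H →L[ℂ] H)

/-- A type I factor: a factor with a minimal nonzero projection. -/
def IsTypeIFactor (M : VonNeumannAlgebra H) : Prop :=
  IsFactor M ∧ ∃ p ∈ M, IsStarProjection p ∧ p ≠ 0 ∧
    ∀ q ∈ M, IsStarProjection q → q ≤ p → q = 0 ∨ q = p

/-- `E` is a faithful normal conditional expectation from `M` onto `N ⊆ M`. Normality is
preservation of suprema of bounded increasing nets of positive elements. -/
structure IsFaithfulNormalCondExp {M N : StarSubalgebra ℂ (H →L[ℂ] H)} (hNM : N ≤ M)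
    (E : M →ₗ[ℂ] N) : Prop where
  map_one : E 1 = 1
  bimodule : ∀ (n₁ n₂ : N) (x : M),
    E (StarSubalgebra.inclusion hNM n₁ * x * StarSubalgebra.inclusion hNM n₂) = n₁ * E x * n₂
  positive : ∀ x : M, (0 : H →L[ℂ] H) ≤ (E (star x * x) : H →L[ℂ] H)
  faithful : ∀ x : M, E (star x * x) = 0 → x = 0
  normal : ∀ D : Set M, D.Nonempty → DirectedOn (· ≤ ·) D → (∀ x ∈ D, 0 ≤ x) →
    ∀ s : M, IsLUB D s → IsLUB (E '' D) (E s)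

/-- The closed linear span of `{a x : a ∈ S}`. -/
def cyclicSubspace (S : Set (H →L[ℂ] H)) (x : H) : Submodule ℂ H :=
  (Submodule.span ℂ ((fun a : H →L[ℂ] H => a x) '' S)).topologicalClosure

instance cyclicSubspace_completeSpace (S : Set (H →L[ℂ] H)) (x : H) :
    CompleteSpace (cyclicSubspace S x) :=
  (Submodule.isClosed_topologicalClosure _).completeSpace_coe

/-- A code subspace renormalization scheme, presented on its unregulated code subspace: `H` is the
GNS space of the faithful normal state `ω = ⟨Ω, · Ω⟩` on `M`, that is, `Ω` is a cyclic and separating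
unit vector for `M`. -/
structure CodeRenormalizationScheme (Λ : Type*) [PartialOrder Λ] (H : Type*)
    [NormedAddCommGroup H] [InnerProductSpace ℂ H] [CompleteSpace H] where
  /-- the bulk algebra -/
  M : VonNeumannAlgebra H
  isFactor : IsFactor M
  /-- the regulated algebras `M_l` -/
  sub : Λ → VonNeumannAlgebra H
  sub_typeI : ∀ l, IsTypeIFactor (sub l)
  sub_le : ∀ l, (sub l).toStarSubalgebra ≤ M.toStarSubalgebra
  sub_mono : ∀ {l k : Λ}, k ≤ l → (sub k).toStarSubalgebra ≤ (sub l).toStarSubalgebra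
  /-- the conditional expectations `M → M_l` -/
  exp : ∀ l, M.toStarSubalgebra →ₗ[ℂ] (sub l).toStarSubalgebra
  exp_isCondExp : ∀ l, IsFaithfulNormalCondExp (sub_le l) (exp l)
  /-- the conditional expectations `M_l → M_k` for `k ≤ l` -/
  flow : ∀ {l k : Λ}, k ≤ l → ((sub l).toStarSubalgebra →ₗ[ℂ] (sub k).toStarSubalgebra)
  flow_isCondExp : ∀ {l k : Λ} (h : k ≤ l), IsFaithfulNormalCondExp (sub_mono h) (flow h)
  exp_eq_flow_comp : ∀ {l k : Λ} (h : k ≤ l), exp k = flow h ∘ₗ exp l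
  flow_comp : ∀ {l k j : Λ} (hkl : k ≤ l) (hjk : j ≤ k),
    flow (hjk.trans hkl) = flow hjk ∘ₗ flow hkl
  /-- the GNS vector of `ω` -/
  Ω : H
  norm_Ω : ‖Ω‖ = 1
  cyclic : cyclicSubspace (M : Set (H →L[ℂ] H)) Ω = ⊤
  separating : ∀ x ∈ M, x Ω = 0 → x = 0
  invariant : ∀ l (x : M.toStarSubalgebra),
    inner ℂ Ω ((exp l x : H →L[ℂ] H) Ω) = inner ℂ Ω ((x : H →L[ℂ] H) Ω)

namespace CodeRenormalizationScheme

variable {Λ : Type*} [PartialOrder Λ] (C : CodeRenormalizationScheme Λ H) (l : Λ)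

/-- The regulated code subspace `H_l`, the closed span of `M_l Ω`. -/
abbrev codeSubspace : Submodule ℂ H :=
  cyclicSubspace (C.sub l : Set (H →L[ℂ] H)) C.Ω

/-- `M_l^L`: the algebra `M_l` acting on `H_l`. -/
def leftAlg : Set (C.codeSubspace l →L[ℂ] C.codeSubspace l) :=
  {T | ∃ a ∈ C.sub l, ∀ x : C.codeSubspace l, ((T x : C.codeSubspace l) : H) = a (x : H)}

/-- `M_l^R`: the commutant of `M_l` on `H_l`. -/
def rightAlg : Set (C.codeSubspace l →L[ℂ] C.codeSubspace l) :=
  Set.centralizer (C.leftAlg l)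

/-- The unitary operators of `M_l^L`. -/
abbrev LeftUnitary : Type _ :=
  {U : C.codeSubspace l →L[ℂ] C.codeSubspace l // U ∈ unitary _ ∧ U ∈ C.leftAlg l}

/-- The unitary operators of `M_l^R`. -/
abbrev RightUnitary : Type _ :=
  {U : C.codeSubspace l →L[ℂ] C.codeSubspace l // U ∈ unitary _ ∧ U ∈ C.rightAlg l}

/-- An identification `H_l ≅ H_l^L ⊗ H_l^R` with `H_l^L = H_l^R = ℂ^d`, under which
`M_l^L = B(H_l^L) ⊗ 1` (hence `M_l^R = 1 ⊗ B(H_l^R)`). -/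
structure Factorization (d : ℕ) where
  toIso : C.codeSubspace l ≃ₗᵢ[ℂ]
    EuclideanSpace ℂ (Fin d) ⊗[ℂ] EuclideanSpace ℂ (Fin d)
  left_iff : ∀ T : C.codeSubspace l →L[ℂ] C.codeSubspace l, T ∈ C.leftAlg l ↔
    ∃ A : EuclideanSpace ℂ (Fin d) →ₗ[ℂ] EuclideanSpace ℂ (Fin d),
      ∀ x, toIso (T x) = LinearMap.rTensor (EuclideanSpace ℂ (Fin d)) A (toIso x)

variable {C l}

/-- `S(ψ, M_l^L)` for `ψ ∈ H_l`, computed through `M_l^L ≅ B(H_l^L)`. -/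
def Factorization.bulkEntropy {d : ℕ} (F : C.Factorization l d) (ψ : C.codeSubspace l) : ℝ :=
  leftEntropy (F.toIso ψ)

/-- `A(H_{L,l})`: the area term of the restriction to `H_l ≅ H_l^L ⊗ H_l^R` of a bulk-to-boundary
map `V : H → K_L ⊗ K_R`. -/
def Factorization.area {d : ℕ} (F : C.Factorization l d) {KL KR : Type*}
    [NormedAddCommGroup KL] [InnerProductSpace ℂ KL] [FiniteDimensional ℂ KL]
    [NormedAddCommGroup KR] [InnerProductSpace ℂ KR] [FiniteDimensional ℂ KR]
    (V : H →L[ℂ] KL ⊗[ℂ] KR) : ℝ :=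
  areaTerm (V.toLinearMap ∘ₗ (C.codeSubspace l).subtype ∘ₗ F.toIso.symm.toLinearEquiv.toLinearMap)

end CodeRenormalizationScheme

end Scheme

/-- A renormalizable large-`N` holographic code with finite-dimensional boundary Hilbert spaces
`K N`: contractive maps `V N : 𝓗 N → K N ⊗ K N`, where `𝓗 N` is the unregulated code subspace of a
renormalization scheme indexed by `Λ`. The scheme is allowed to depend on `N`; the left boundary is
the first tensor factor, the right boundary the second. -/
structure LargeNCode (Λ : Type*) [PartialOrder Λ] (𝓗 : ℕ → Type*)
    [∀ N, NormedAddCommGroup (𝓗 N)] [∀ N, InnerProductSpace ℂ (𝓗 N)] [∀ N, CompleteSpace (𝓗 N)]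
    (K : ℕ → Type*) [∀ N, NormedAddCommGroup (K N)] [∀ N, InnerProductSpace ℂ (K N)]
    [∀ N, FiniteDimensional ℂ (K N)] where
  scheme : ∀ N, CodeRenormalizationScheme Λ (𝓗 N)
  V : ∀ N, 𝓗 N →L[ℂ] K N ⊗[ℂ] K N
  contractive : ∀ N, ‖V N‖ ≤ 1

end

/-! The proof is quantum teleportation combined with continuity of entropy. Identify `Ψ` with `φ` in
`ℂ^d ⊗ ℂ^d` and let `W` be the code on that space. Expand the tensor product of the
Choi–Jamiołkowski vector and `φ`, on the left and on the right separately, in generalized Bell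
vectors of (reference factor) ⊗ (factor of `φ`). The Bell component labelled by unitaries `g`, `h`
is `W (g ⊗ h) φ`, up to the factor `d⁻²` (`decoupling_identity`).

By reconstruction, `W (g ⊗ h) φ` is within `δ` of a product of boundary unitaries, one depending on
`g` and one on `h`, applied to a single vector `ψ`. Since the Bell vectors are orthonormal, summing
these unitaries coherently against them gives an isometry on each side (`controlledIsometry`). Hence
the product vector is within `d² δ` of the image of `ψ` under local isometries, and that image has
the entropy of `ψ`. The product vector itself has entropy area + `‖CJ‖²` · (entropy of `φ`). A
Fannes bound (`abs_leftEntropy_sub_le`) compares the two entropies, and the same estimate forces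
`‖CJ‖` to `1`. The boundary dimension enters only through its logarithm, which `δ` beats.

The identification of the code subspace comes from matrix units of a finite-dimensional factor
(`exists_matrixUnits`). The multiplicity space has dimension `d` because the separating vector makes
`dim H_l = dim M_l`. -/

noncomputable section

/-! ### Schmidt decompositions and exact entropy formulas -/

section Entropy

variable {A B A' B' : Type*}
  [NormedAddCommGroup A] [InnerProductSpace ℂ A]
  [NormedAddCommGroup B] [InnerProductSpace ℂ B]
  [NormedAddCommGroup A'] [InnerProductSpace ℂ A']
  [NormedAddCommGroup B'] [InnerProductSpace ℂ B']

/-- Each diagonal entry is an average of eigenvalues with weights `‖⟨a i, c j⟩‖²`. These weights are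
doubly stochastic, so Jensen's inequality for the concave `negMulLog` gives the bound. -/
theorem sum_negMulLog_le_of_eigenbasis {ι κ : Type*} [Fintype ι] [Fintype κ]
    (ρ : A →ₗ[ℂ] A) (a : OrthonormalBasis ι ℂ A) (c : OrthonormalBasis κ ℂ A)
    (μ : ι → ℝ) (hμ : ∀ i, 0 ≤ μ i) (ha : ∀ i, ρ (a i) = (μ i : ℂ) • a i)
    (m : κ → ℝ) (hm : ∀ j, inner ℂ (c j) (ρ (c j)) = (m j : ℂ)) :
    ∑ i, Real.negMulLog (μ i) ≤ ∑ j, Real.negMulLog (m j) := by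
  have key : ∀ j, m j = ∑ i, ‖inner ℂ (a i) (c j)‖ ^ 2 * μ i := by
    intro j
    have h1 : ρ (c j) = ∑ i, (inner ℂ (a i) (c j) * (μ i : ℂ)) • a i := by
      conv_lhs => rw [← a.sum_repr' (c j)]
      simp only [map_sum, map_smul, ha, smul_smul]
    have h2 : ((m j : ℝ) : ℂ) = ((∑ i, ‖inner ℂ (a i) (c j)‖ ^ 2 * μ i : ℝ) : ℂ) := by
      rw [← hm, h1, inner_sum]
      push_cast
      refine Finset.sum_congr rfl fun i _ => ?_
      rw [inner_smul_right, ← inner_conj_symm (c j) (a i), ← Complex.mul_conj']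
      ring
    exact_mod_cast h2
  calc ∑ i, Real.negMulLog (μ i)
      = ∑ i, (∑ j, ‖inner ℂ (a i) (c j)‖ ^ 2) * Real.negMulLog (μ i) := by
        simp [c.sum_sq_norm_inner_left]
    _ = ∑ j, ∑ i, ‖inner ℂ (a i) (c j)‖ ^ 2 * Real.negMulLog (μ i) := by
        simp_rw [Finset.sum_mul]; exact Finset.sum_comm
    _ ≤ ∑ j, Real.negMulLog (m j) := by
        refine Finset.sum_le_sum fun j _ => ?_
        rw [key j]
        have := Real.concaveOn_negMulLog.le_map_sum (t := Finset.univ)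
          (w := fun i => ‖inner ℂ (a i) (c j)‖ ^ 2) (p := μ) (fun i _ => by positivity)
          (by simp [a.sum_sq_norm_inner_right]) (fun i _ => hμ i)
        simpa using this

theorem vonNeumannEntropy_le [FiniteDimensional ℂ A] {κ : Type*} [Fintype κ]
    (ρ : A →ₗ[ℂ] A) (hρ : ρ.IsSymmetric) (hpos : ∀ x, 0 ≤ (inner ℂ x (ρ x)).re)
    (c : OrthonormalBasis κ ℂ A)
    (m : κ → ℝ) (hm : ∀ j, inner ℂ (c j) (ρ (c j)) = (m j : ℂ)) :
    vonNeumannEntropy ρ hρ ≤ ∑ j, Real.negMulLog (m j) := by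
  refine sum_negMulLog_le_of_eigenbasis ρ (hρ.eigenvectorBasis rfl) c _ (fun i => ?_)
    (fun i => hρ.apply_eigenvectorBasis rfl i) m hm
  have := hpos (hρ.eigenvectorBasis rfl i)
  rw [hρ.apply_eigenvectorBasis rfl i, inner_smul_right] at this
  simpa using this

/-- Two eigenbases each bound the other by Jensen, so the entropy can be read off any of them
without matching eigenvalue lists. -/
theorem vonNeumannEntropy_eq_of_eigenbasis [FiniteDimensional ℂ A] {ι : Type*} [Fintype ι]
    (ρ : A →ₗ[ℂ] A) (hρ : ρ.IsSymmetric) (a : OrthonormalBasis ι ℂ A)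
    (μ : ι → ℝ) (hμ : ∀ i, 0 ≤ μ i) (ha : ∀ i, ρ (a i) = (μ i : ℂ) • a i) :
    vonNeumannEntropy ρ hρ = ∑ i, Real.negMulLog (μ i) := by
  refine le_antisymm (vonNeumannEntropy_le ρ hρ (fun x => ?_) a μ fun i => ?_) ?_
  · have h1 : ρ x = ∑ i, (inner ℂ (a i) x * (μ i : ℂ)) • a i := by
      conv_lhs => rw [← a.sum_repr' x]
      simp only [map_sum, map_smul, ha, smul_smul]
    have h2 : inner ℂ x (ρ x) = ((∑ i, ‖inner ℂ (a i) x‖ ^ 2 * μ i : ℝ) : ℂ) := by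
      rw [h1, inner_sum]
      push_cast
      refine Finset.sum_congr rfl fun i _ => ?_
      rw [inner_smul_right, ← inner_conj_symm x (a i), ← Complex.mul_conj']
      ring
    rw [h2, Complex.ofReal_re]
    exact Finset.sum_nonneg fun i _ => mul_nonneg (by positivity) (hμ i)
  · rw [ha, inner_smul_right]; simp
  · refine sum_negMulLog_le_of_eigenbasis ρ a (hρ.eigenvectorBasis rfl) μ hμ ha _ fun j => ?_
    rw [hρ.apply_eigenvectorBasis rfl j, inner_smul_right]; simp

theorem vonNeumannEntropy_eq_of_orthonormal [FiniteDimensional ℂ A] {ι : Type*} [Fintype ι]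
    (ρ : A →ₗ[ℂ] A) (hρ : ρ.IsSymmetric) (a : ι → A) (hon : Orthonormal ℂ a)
    (μ : ι → ℝ) (hμ : ∀ i, 0 ≤ μ i)
    (ha : ∀ x, ρ x = ∑ i, ((μ i : ℂ) * inner ℂ (a i) x) • a i) :
    vonNeumannEntropy ρ hρ = ∑ i, Real.negMulLog (μ i) := by
  classical
  have hcard : Fintype.card ι ≤ Module.finrank ℂ A := hon.linearIndependent.fintype_card_le_finrank
  -- `κ` indexes the missing directions; they carry the eigenvalue `0`, which adds no entropy.
  let κ := Fin (Module.finrank ℂ A - Fintype.card ι)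
  have hres : Orthonormal ℂ ((Set.range (Sum.inl : ι → ι ⊕ κ)).domRestrict (Sum.elim a fun _ => 0)) := by
    constructor
    · rintro ⟨_, i, rfl⟩
      exact hon.1 i
    · rintro ⟨_, i, rfl⟩ ⟨_, j, rfl⟩ hij
      exact hon.2 (fun h => hij (by simp [h]))
  obtain ⟨b, hb⟩ := hres.exists_orthonormalBasis_extension_of_card_eq
    (by simp [κ]; omega)
  have hbl : ∀ i, b (Sum.inl i) = a i := fun i => by simpa using hb _ ⟨i, rfl⟩
  rw [vonNeumannEntropy_eq_of_eigenbasis ρ hρ b (Sum.elim μ fun _ => 0)]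
  · simp
  · rintro (i | i) <;> simp [hμ]
  · rintro (j | j)
    · rw [ha, hbl]
      simp [orthonormal_iff_ite.mp hon]
    · rw [ha]
      have : ∀ i, inner ℂ (a i) (b (Sum.inr j)) = 0 := fun i => by
        rw [← hbl]; exact b.orthonormal.2 (by simp)
      simp [this]

theorem partialInner_tmul (b : B) (x : A) (y : B) :
    partialInner b (x ⊗ₜ[ℂ] y) = (inner ℂ b y : ℂ) • x := by
  simp [partialInner]

theorem inner_partialInner (x : A) (b : B) (v : A ⊗[ℂ] B) :
    inner ℂ x (partialInner b v) = inner ℂ (x ⊗ₜ[ℂ] b) v := by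
  induction v using TensorProduct.induction_on with
  | zero => simp
  | tmul y z => simp [partialInner_tmul, mul_comm]
  | add v w hv hw => simp [inner_add_right, hv, hw]

theorem reducedDensity_apply [FiniteDimensional ℂ B] (v : A ⊗[ℂ] B) (x : A) :
    reducedDensity v x = ∑ i, (inner ℂ (partialInner (stdOrthonormalBasis ℂ B i) v) x : ℂ) •
      partialInner (stdOrthonormalBasis ℂ B i) v := by
  simp [reducedDensity, LinearMap.sum_apply, InnerProductSpace.rankOne_apply]

theorem inner_reducedDensity [FiniteDimensional ℂ B] (v : A ⊗[ℂ] B) (x y : A) :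
    inner ℂ x (reducedDensity v y) = ∑ i, inner ℂ (x ⊗ₜ[ℂ] stdOrthonormalBasis ℂ B i) v *
      inner ℂ v (y ⊗ₜ[ℂ] stdOrthonormalBasis ℂ B i) := by
  rw [reducedDensity_apply, inner_sum]
  refine Finset.sum_congr rfl fun i _ => ?_
  rw [inner_smul_right, inner_partialInner, ← inner_conj_symm _ y, inner_partialInner, mul_comm]
  congr 1
  exact inner_conj_symm (𝕜 := ℂ) v (y ⊗ₜ[ℂ] stdOrthonormalBasis ℂ B i)

theorem inner_reducedDensity_self [FiniteDimensional ℂ B] (v : A ⊗[ℂ] B) (x : A) :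
    inner ℂ x (reducedDensity v x) =
      ((∑ i, ‖inner ℂ (x ⊗ₜ[ℂ] stdOrthonormalBasis ℂ B i) v‖ ^ 2 : ℝ) : ℂ) := by
  rw [inner_reducedDensity]
  push_cast
  refine Finset.sum_congr rfl fun i _ => ?_
  rw [← inner_conj_symm v, Complex.mul_conj']

theorem leftEntropy_le_sum [FiniteDimensional ℂ A] [FiniteDimensional ℂ B] {κ : Type*} [Fintype κ]
    (v : A ⊗[ℂ] B) (c : OrthonormalBasis κ ℂ A) :
    leftEntropy v ≤ ∑ k, Real.negMulLog
      (∑ i, ‖inner ℂ (c k ⊗ₜ[ℂ] stdOrthonormalBasis ℂ B i) v‖ ^ 2) := by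
  refine vonNeumannEntropy_le _ _ (fun x => ?_) c _ fun j => inner_reducedDensity_self v _
  rw [inner_reducedDensity_self, Complex.ofReal_re]
  positivity

/-- Orthogonality of the `c i` makes the reduced density diagonal in the `a i`. The `c i` need not
be normalized and may vanish, which suits subnormalized vectors. -/
theorem leftEntropy_sum_tmul [FiniteDimensional ℂ A] [FiniteDimensional ℂ B]
    {ι : Type*} [Fintype ι] (a : ι → A) (ha : Orthonormal ℂ a) (c : ι → B)
    (hc : Pairwise fun i j => inner ℂ (c i) (c j) = 0) :
    leftEntropy (∑ i, a i ⊗ₜ[ℂ] c i) = ∑ i, Real.negMulLog (‖c i‖ ^ 2) := by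
  classical
  refine vonNeumannEntropy_eq_of_orthonormal _ _ a ha _ (fun i => by positivity) fun x => ?_
  set b := stdOrthonormalBasis ℂ B
  have hp : ∀ i, partialInner (b i) (∑ k, a k ⊗ₜ[ℂ] c k) = ∑ k, inner ℂ (b i) (c k) • a k := by
    intro i; simp [partialInner_tmul]
  rw [reducedDensity_apply]
  calc _ = ∑ i, ∑ l, ∑ k, (inner ℂ (c k) (b i) * inner ℂ (a k) x * inner ℂ (b i) (c l)) • a l := by
        refine Finset.sum_congr rfl fun i _ => ?_
        rw [show stdOrthonormalBasis ℂ B i = b i from rfl, hp, Finset.smul_sum]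
        refine Finset.sum_congr rfl fun l _ => ?_
        rw [sum_inner, smul_smul, Finset.sum_mul, Finset.sum_smul]
        refine Finset.sum_congr rfl fun k _ => ?_
        rw [inner_smul_left, inner_conj_symm]
    _ = ∑ l, (∑ k, inner ℂ (a k) x * ∑ i, inner ℂ (c k) (b i) * inner ℂ (b i) (c l)) • a l := by
        rw [Finset.sum_comm]
        refine Finset.sum_congr rfl fun l _ => ?_
        rw [Finset.sum_comm, Finset.sum_smul]
        refine Finset.sum_congr rfl fun k _ => ?_
        rw [Finset.mul_sum, Finset.sum_smul]
        refine Finset.sum_congr rfl fun i _ => ?_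
        ring_nf
    _ = _ := by
        refine Finset.sum_congr rfl fun l _ => ?_
        congr 1
        simp_rw [b.sum_inner_mul_inner]
        rw [Finset.sum_eq_single l]
        · rw [inner_self_eq_norm_sq_to_K]; push_cast; simp [mul_comm]
        · intro k _ hk; rw [hc hk, mul_zero]
        · simp

/-- Schmidt decomposition. -/
theorem exists_schmidt [FiniteDimensional ℂ A] [FiniteDimensional ℂ B] (v : A ⊗[ℂ] B) :
    ∃ (a : OrthonormalBasis (Fin (Module.finrank ℂ A)) ℂ A) (c : Fin (Module.finrank ℂ A) → B),
      (Pairwise fun i j => inner ℂ (c i) (c j) = 0) ∧ v = ∑ i, a i ⊗ₜ[ℂ] c i := by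
  set hρ := reducedDensity_isSymmetric v
  set a := hρ.eigenvectorBasis rfl
  set b := stdOrthonormalBasis ℂ B
  -- `c k` is the component of `v` along `a k`. Inner products of distinct `c k` are off-diagonal
  -- entries of the reduced density, which vanish in its eigenbasis.
  refine ⟨a, fun k => ∑ i, inner ℂ (a k ⊗ₜ[ℂ] b i) v • b i, fun k l hkl => ?_, ?_⟩
  · have h1 : inner ℂ (a l) (reducedDensity v (a k)) = 0 := by
      rw [hρ.apply_eigenvectorBasis rfl k, inner_smul_right, a.orthonormal.2 hkl.symm, mul_zero]
    rw [inner_reducedDensity] at h1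
    rw [← h1]
    beta_reduce
    rw [b.orthonormal.inner_sum]
    refine Finset.sum_congr rfl fun i _ => ?_
    rw [mul_comm]
    congr 1
    exact inner_conj_symm (𝕜 := ℂ) v (a k ⊗ₜ[ℂ] b i)
  · conv_lhs => rw [← (a.tensorProduct b).sum_repr' v]
    rw [Fintype.sum_prod_type]
    refine Finset.sum_congr rfl fun k _ => ?_
    rw [TensorProduct.tmul_sum]
    refine Finset.sum_congr rfl fun i _ => ?_
    simp

theorem norm_sq_sum_tmul {ι : Type*} [Fintype ι] (a : ι → A) (ha : Orthonormal ℂ a) (c : ι → B) :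
    ‖∑ i, a i ⊗ₜ[ℂ] c i‖ ^ 2 = ∑ i, ‖c i‖ ^ 2 := by
  classical
  have h : inner ℂ (∑ i, a i ⊗ₜ[ℂ] c i) (∑ i, a i ⊗ₜ[ℂ] c i) = ((∑ i, ‖c i‖ ^ 2 : ℝ) : ℂ) := by
    simp only [sum_inner, inner_sum, TensorProduct.inner_tmul, orthonormal_iff_ite.mp ha]
    push_cast
    refine Finset.sum_congr rfl fun i _ => ?_
    simp [inner_self_eq_norm_sq_to_K]
  have h' := (inner_self_eq_norm_sq_to_K (𝕜 := ℂ) (∑ i, a i ⊗ₜ[ℂ] c i)).symm.trans h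
  rw [← Complex.ofReal_inj]
  simpa using h'

/-- Local isometries carry a Schmidt decomposition to a Schmidt decomposition with the same
coefficients. -/
theorem leftEntropy_map [FiniteDimensional ℂ A] [FiniteDimensional ℂ B]
    [FiniteDimensional ℂ A'] [FiniteDimensional ℂ B'] (f : A →ₗᵢ[ℂ] A') (g : B →ₗᵢ[ℂ] B')
    (v : A ⊗[ℂ] B) :
    leftEntropy (TensorProduct.map f.toLinearMap g.toLinearMap v) = leftEntropy v := by
  obtain ⟨a, c, hc, rfl⟩ := exists_schmidt v
  rw [leftEntropy_sum_tmul _ a.orthonormal c hc, map_sum]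
  simp only [TensorProduct.map_tmul, LinearIsometry.coe_toLinearMap]
  rw [leftEntropy_sum_tmul (fun i => f (a i)) (a.orthonormal.comp_linearIsometry f)
    (fun i => g (c i)) (fun i j hij => by simpa using hc hij)]
  simp

/-- Products of Schmidt terms form a Schmidt decomposition of the regrouped vector. Additivity of
entropy acquires squared norms because neither factor is normalized. -/
theorem leftEntropy_tensorTensorTensorComm_tmul [FiniteDimensional ℂ A] [FiniteDimensional ℂ B]
    [FiniteDimensional ℂ A'] [FiniteDimensional ℂ B'] (v : A ⊗[ℂ] B) (w : A' ⊗[ℂ] B') :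
    leftEntropy (TensorProduct.tensorTensorTensorComm ℂ A B A' B' (v ⊗ₜ[ℂ] w)) =
      ‖w‖ ^ 2 * leftEntropy v + ‖v‖ ^ 2 * leftEntropy w ∧
    ‖TensorProduct.tensorTensorTensorComm ℂ A B A' B' (v ⊗ₜ[ℂ] w)‖ = ‖v‖ * ‖w‖ := by
  obtain ⟨a, c, hc, rfl⟩ := exists_schmidt v
  obtain ⟨a', c', hc', rfl⟩ := exists_schmidt w
  have hon : Orthonormal ℂ (fun x : Fin (Module.finrank ℂ A) × Fin (Module.finrank ℂ A') =>
      a x.1 ⊗ₜ[ℂ] a' x.2) := by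
    convert (a.tensorProduct a').orthonormal using 2 with x
    exact (a.tensorProduct_apply' a' x).symm
  have hs : TensorProduct.tensorTensorTensorComm ℂ A B A' B'
      ((∑ i, a i ⊗ₜ[ℂ] c i) ⊗ₜ[ℂ] (∑ i, a' i ⊗ₜ[ℂ] c' i)) =
      ∑ x : Fin (Module.finrank ℂ A) × Fin (Module.finrank ℂ A'),
        (a x.1 ⊗ₜ[ℂ] a' x.2) ⊗ₜ[ℂ] (c x.1 ⊗ₜ[ℂ] c' x.2) := by
    simp only [TensorProduct.sum_tmul, TensorProduct.tmul_sum, Fintype.sum_prod_type, map_sum,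
      TensorProduct.tensorTensorTensorComm_tmul]
    rw [Finset.sum_comm]
  rw [hs]
  constructor
  · rw [leftEntropy_sum_tmul _ hon (fun x => c x.1 ⊗ₜ[ℂ] c' x.2), leftEntropy_sum_tmul _ a.orthonormal c hc,
      leftEntropy_sum_tmul _ a'.orthonormal c' hc', norm_sq_sum_tmul _ a.orthonormal,
      norm_sq_sum_tmul _ a'.orthonormal, Fintype.sum_prod_type]
    · simp only [TensorProduct.norm_tmul, mul_pow, Real.negMulLog_mul, Finset.sum_add_distrib,
        ← Finset.mul_sum, ← Finset.sum_mul]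
    · rintro ⟨i, j⟩ ⟨k, l⟩ h
      rw [TensorProduct.inner_tmul]
      by_cases hik : i = k
      · have : j ≠ l := fun hjl => h (by rw [hik, hjl])
        rw [hc' this, mul_zero]
      · rw [hc hik, zero_mul]
  · rw [← sq_eq_sq₀ (by positivity) (by positivity), mul_pow,
      norm_sq_sum_tmul (fun x : _ × _ => a x.1 ⊗ₜ[ℂ] a' x.2) hon (fun x => c x.1 ⊗ₜ[ℂ] c' x.2),
      norm_sq_sum_tmul _ a.orthonormal, norm_sq_sum_tmul _ a'.orthonormal, Fintype.sum_prod_type]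
    simp [mul_pow, Finset.sum_mul_sum]

end Entropy

/-! ### Fannes-type continuity of entropy -/

section Entropy

open Real in
-- If `q ≤ p`, this is subadditivity of `negMulLog` applied to `p = q + (p - q)`. If `p < q`, the
-- inequality `log t ≤ t - 1` bounds the difference by `q - p` alone.
theorem negMulLog_sub_le {p q : ℝ} (hp : 0 ≤ p) (hq : 0 ≤ q) (hp1 : p ≤ 1) (hq1 : q ≤ 1) :
    negMulLog p - negMulLog q ≤ negMulLog |p - q| + |p - q| := by
  rcases hp.eq_or_lt with rfl | hp
  · have := negMulLog_nonneg hq hq1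
    simp only [negMulLog_zero, zero_sub, abs_neg, abs_of_nonneg hq]
    linarith
  rcases le_or_gt q p with h | h
  · rw [abs_of_nonneg (sub_nonneg.2 h)]
    rcases hq.eq_or_lt with rfl | hq
    · simp [hp.le]
    rcases h.eq_or_lt with rfl | h
    · simp
    have h1 : log q ≤ log p := log_le_log hq h.le
    have h2 : log (p - q) ≤ log p := log_le_log (by linarith) (by linarith)
    simp only [negMulLog]
    nlinarith
  · rw [abs_of_neg (by linarith)]
    have hq : 0 < q := hp.trans h
    have h1 : 0 ≤ negMulLog (-(p - q)) := negMulLog_nonneg (by linarith) (by linarith)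
    have h2 : log q - log p ≤ q / p - 1 := by
      rw [← log_div hq.ne' hp.ne']; exact log_le_sub_one_of_pos (by positivity)
    have h3 : log q ≤ 0 := log_nonpos hq.le hq1
    have h4 : p * (q / p - 1) = q - p := by field_simp
    have h5 := mul_le_mul_of_nonneg_left h2 hp.le
    have h6 : (q - p) * log q ≤ 0 := mul_nonpos_of_nonneg_of_nonpos (by linarith) h3
    simp only [negMulLog] at *
    linarith

open Real in
-- The tangent line at `c` lies above the concave function; a summand `-x` is dropped. A slope
-- common to all indices lets the estimate be summed linearly.
theorem negMulLog_le_tangent {x c : ℝ} (hx : 0 ≤ x) (hc : 0 < c) :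
    negMulLog x ≤ -x * log c + c := by
  rcases hx.eq_or_lt with rfl | hx
  · simp [hc.le]
  have h : log c - log x ≤ c / x - 1 := by
    rw [← log_div hc.ne' hx.ne']; exact log_le_sub_one_of_pos (by positivity)
  have h4 : x * (c / x - 1) = c - x := by field_simp
  have h5 := mul_le_mul_of_nonneg_left h hx.le
  simp only [negMulLog]
  linarith

open Real in
theorem sum_negMulLog_sub_le {ι : Type*} [Fintype ι] (p q : ι → ℝ) (hp : ∀ i, 0 ≤ p i)
    (hq : ∀ i, 0 ≤ q i) (hp1 : ∀ i, p i ≤ 1) (hq1 : ∀ i, q i ≤ 1) {ε : ℝ} (hε : ε ≤ 1)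
    (h : ∑ i, |p i - q i| ≤ ε) :
    ∑ i, negMulLog (p i) - ∑ i, negMulLog (q i) ≤
      ε * log (Fintype.card ι) + negMulLog ε + 2 * ε := by
  have hε0 : 0 ≤ ε := (Finset.sum_nonneg fun i _ => abs_nonneg _).trans h
  rcases isEmpty_or_nonempty ι with hι | hι
  · have := negMulLog_nonneg hε0 hε
    simp; linarith
  have hD : (1 : ℝ) ≤ Fintype.card ι := by exact_mod_cast Fintype.card_pos
  rcases hε0.eq_or_lt with rfl | hε0
  · have h0 : ∀ i, p i = q i := fun i => by
      have h1 := Finset.single_le_sum (f := fun i => |p i - q i|) (fun i _ => abs_nonneg _)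
        (Finset.mem_univ i)
      exact sub_eq_zero.1 (abs_nonpos_iff.1 (h1.trans h))
    simp [h0]
  -- With this point of tangency the constants `c` add up to `ε`, and `-log c` supplies both `log
  -- (card ι)` and `-log ε`. The condition `ε ≤ 1` makes `-log c` nonnegative.
  set c := ε / Fintype.card ι
  have hc : 0 < c := by positivity
  have hlogc : log c = log ε - log (Fintype.card ι) := log_div hε0.ne' (by positivity)
  have hc0 : 0 ≤ -log c := by
    have := log_nonpos hε0.le hε
    have := log_nonneg hD
    linarith
  calc ∑ i, negMulLog (p i) - ∑ i, negMulLog (q i)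
      = ∑ i, (negMulLog (p i) - negMulLog (q i)) := by rw [Finset.sum_sub_distrib]
    _ ≤ ∑ i, ((-|p i - q i| * log c + c) + |p i - q i|) := by
        refine Finset.sum_le_sum fun i _ => ?_
        have h1 := negMulLog_sub_le (hp i) (hq i) (hp1 i) (hq1 i)
        have h2 := negMulLog_le_tangent (abs_nonneg (p i - q i)) hc
        linarith
    _ = (∑ i, |p i - q i|) * (-log c) + Fintype.card ι * c + ∑ i, |p i - q i| := by
        simp only [Finset.sum_add_distrib, Finset.sum_const, Finset.card_univ, nsmul_eq_mul,
          neg_mul, mul_neg, Finset.sum_neg_distrib, ← Finset.sum_mul]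
    _ ≤ ε * (-log c) + ε + ε := by
        have h1 := mul_le_mul_of_nonneg_right h hc0
        have h2 : Fintype.card ι * c = ε := by simp only [c]; field_simp
        linarith
    _ = _ := by rw [hlogc]; simp only [negMulLog]; ring

variable {A B : Type*}
  [NormedAddCommGroup A] [InnerProductSpace ℂ A]
  [NormedAddCommGroup B] [InnerProductSpace ℂ B]

theorem sum_abs_norm_sq_sub_le {ι E : Type*} [Fintype ι] [NormedAddCommGroup E]
    [InnerProductSpace ℂ E] (b : OrthonormalBasis ι ℂ E) (v w : E) :
    ∑ i, |‖inner ℂ (b i) v‖ ^ 2 - ‖inner ℂ (b i) w‖ ^ 2| ≤ ‖v - w‖ * (‖v‖ + ‖w‖) := by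
  have cs : ∀ x y : E, ∑ i, ‖inner ℂ (b i) x‖ * ‖inner ℂ (b i) y‖ ≤ ‖x‖ * ‖y‖ := by
    intro x y
    refine abs_le_of_sq_le_sq' ?_ (by positivity) |>.2
    rw [mul_pow, ← b.sum_sq_norm_inner_right x, ← b.sum_sq_norm_inner_right y]
    exact Finset.sum_mul_sq_le_sq_mul_sq _ _ _
  calc ∑ i, |‖inner ℂ (b i) v‖ ^ 2 - ‖inner ℂ (b i) w‖ ^ 2|
      ≤ ∑ i, (‖inner ℂ (b i) (v - w)‖ * ‖inner ℂ (b i) v‖ +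
          ‖inner ℂ (b i) (v - w)‖ * ‖inner ℂ (b i) w‖) := by
        refine Finset.sum_le_sum fun i _ => ?_
        rw [sq_sub_sq, abs_mul, abs_of_nonneg (by positivity : 0 ≤ ‖inner ℂ (b i) v‖ + _),
          inner_sub_right, mul_comm, ← mul_add]
        exact mul_le_mul_of_nonneg_right (abs_norm_sub_norm_le _ _) (by positivity)
    _ ≤ _ := by
        rw [Finset.sum_add_distrib, mul_add]
        exact add_le_add (cs _ _) (cs _ _)

variable [FiniteDimensional ℂ A] [FiniteDimensional ℂ B]

/-- Both vectors are measured in a Schmidt basis of `w`. The entropy of `w` is then exactly the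
classical one and that of `v` is at most the classical one, so the distribution bound suffices. -/
theorem leftEntropy_sub_le {v w : A ⊗[ℂ] B} (hv : ‖v‖ ≤ 1) (hw : ‖w‖ ≤ 1) {ε : ℝ} (hε : 2 * ε ≤ 1)
    (h : ‖v - w‖ ≤ ε) :
    leftEntropy v - leftEntropy w ≤
      2 * ε * Real.log (Module.finrank ℂ A) + Real.negMulLog (2 * ε) + 2 * (2 * ε) := by
  obtain ⟨a, c, hc, hwc⟩ := exists_schmidt w
  set b := stdOrthonormalBasis ℂ B
  have hexp : ∀ x : A ⊗[ℂ] B,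
      ∑ k, ∑ i, ‖inner ℂ (a k ⊗ₜ[ℂ] b i) x‖ ^ 2 = ‖x‖ ^ 2 := fun x => by
    rw [← (a.tensorProduct b).sum_sq_norm_inner_right x, Fintype.sum_prod_type]
    simp
  have hq : leftEntropy w =
      ∑ k, Real.negMulLog (∑ i, ‖inner ℂ (a k ⊗ₜ[ℂ] b i) w‖ ^ 2) := by
    rw [hwc, leftEntropy_sum_tmul _ a.orthonormal c hc]
    refine Finset.sum_congr rfl fun k _ => ?_
    congr 1
    rw [← b.sum_sq_norm_inner_right]
    refine Finset.sum_congr rfl fun i _ => ?_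
    simp [inner_sum, orthonormal_iff_ite.mp a.orthonormal]
  have hle : ∀ x : A ⊗[ℂ] B, ‖x‖ ≤ 1 → ∀ k, ∑ i, ‖inner ℂ (a k ⊗ₜ[ℂ] b i) x‖ ^ 2 ≤ 1 := by
    intro x hx k
    refine (Finset.single_le_sum (f := fun k => ∑ i, ‖inner ℂ (a k ⊗ₜ[ℂ] b i) x‖ ^ 2)
      (fun i _ => by positivity) (Finset.mem_univ k)).trans ?_
    rw [hexp]
    exact pow_le_one₀ (norm_nonneg _) hx
  have h1 := leftEntropy_le_sum v a
  have h2 := sum_negMulLog_sub_le (fun k => ∑ i, ‖inner ℂ (a k ⊗ₜ[ℂ] b i) v‖ ^ 2)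
    (fun k => ∑ i, ‖inner ℂ (a k ⊗ₜ[ℂ] b i) w‖ ^ 2) (fun k => by positivity)
    (fun k => by positivity) (hle v hv) (hle w hw) hε ?_
  · rw [Fintype.card_fin, ← hq] at h2
    linarith
  · calc _ ≤ ∑ k, ∑ i, |‖inner ℂ (a k ⊗ₜ[ℂ] b i) v‖ ^ 2 - ‖inner ℂ (a k ⊗ₜ[ℂ] b i) w‖ ^ 2| := by
          refine Finset.sum_le_sum fun k _ => ?_
          rw [← Finset.sum_sub_distrib]
          exact Finset.abs_sum_le_sum_abs _ _
      _ ≤ ‖v - w‖ * (‖v‖ + ‖w‖) := by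
          have := sum_abs_norm_sq_sub_le (a.tensorProduct b) v w
          rw [Fintype.sum_prod_type] at this
          simpa using this
      -- The factor `2` in the bound is `‖v‖ + ‖w‖ ≤ 2`, from differences of squared amplitudes.
      _ ≤ ε * (1 + 1) := by
          gcongr
          exact (norm_nonneg _).trans h
      _ = 2 * ε := by ring

/-- A continuity bound for the entropy of vectors, in the style of Fannes. -/
theorem abs_leftEntropy_sub_le {v w : A ⊗[ℂ] B} (hv : ‖v‖ ≤ 1) (hw : ‖w‖ ≤ 1) {ε : ℝ}
    (hε : 2 * ε ≤ 1) (h : ‖v - w‖ ≤ ε) :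
    |leftEntropy v - leftEntropy w| ≤
      2 * ε * Real.log (Module.finrank ℂ A) + Real.negMulLog (2 * ε) + 2 * (2 * ε) := by
  rw [abs_sub_le_iff]
  exact ⟨leftEntropy_sub_le hv hw hε h, leftEntropy_sub_le hw hv hε (by rwa [norm_sub_rev])⟩

/-- A crude bound, from `negMulLog x ≤ 1 - x ≤ 1` for each eigenvalue; it is applied only to the
bulk factor of fixed dimension `d`. -/
theorem abs_leftEntropy_le {v : A ⊗[ℂ] B} (hv : ‖v‖ ≤ 1) :
    |leftEntropy v| ≤ Module.finrank ℂ A := by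
  obtain ⟨a, c, hc, rfl⟩ := exists_schmidt v
  have hn := norm_sq_sum_tmul _ a.orthonormal c
  have hle : ∀ k, ‖c k‖ ^ 2 ≤ 1 := fun k =>
    (Finset.single_le_sum (f := fun k => ‖c k‖ ^ 2) (fun i _ => by positivity)
      (Finset.mem_univ k)).trans (hn ▸ pow_le_one₀ (norm_nonneg _) hv)
  rw [leftEntropy_sum_tmul _ a.orthonormal c hc, abs_of_nonneg]
  · refine (Finset.sum_le_sum fun k _ => ?_).trans (b := ∑ k, (1 : ℝ)) (by simp)
    have := Real.negMulLog_le_one_sub_self (sq_nonneg ‖c k‖)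
    nlinarith [sq_nonneg ‖c k‖]
  · exact Finset.sum_nonneg fun k _ => Real.negMulLog_nonneg (by positivity) (hle k)

end Entropy

/-! ### A unitary operator basis -/

section ClockShift

/-- The clock and shift matrices form an orthogonal basis of the `d × d` matrices that
consists of unitaries. -/
theorem exists_orthogonal_unitary_basis (d : ℕ) [NeZero d] :
    ∃ w : ZMod d × ZMod d → Fin d → Fin d → ℂ,
      (∀ i j k l, ∑ g, starRingEnd ℂ (w g i j) * w g k l = if i = k ∧ j = l then (d : ℂ) else 0) ∧
      (∀ g h, ∑ i, ∑ j, w g i j * starRingEnd ℂ (w h i j) = if g = h then (d : ℂ) else 0) ∧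
      (∀ g j l, ∑ i, starRingEnd ℂ (w g i j) * w g i l = if j = l then 1 else 0) := by
  obtain ⟨e⟩ : Nonempty (Fin d ≃ ZMod d) := ⟨Fintype.equivOfCardEq (by simp [ZMod.card])⟩
  let ψ : AddChar (ZMod d) ℂ := ZMod.stdAddChar
  have hψ : ∀ x y : ZMod d, ∑ a, starRingEnd ℂ (ψ (a * x)) * ψ (a * y) =
      if x = y then (d : ℂ) else 0 := by
    intro x y
    have h := AddChar.sum_mulShift (y - x) (ZMod.isPrimitive_stdAddChar d)
    rw [ZMod.card] at h
    simp_rw [← AddChar.map_neg_eq_conj, ← AddChar.map_add_eq_mul]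
    simp only [sub_eq_zero, eq_comm (a := y)] at h
    rw [Nat.cast_ite, Nat.cast_zero] at h
    rw [← h]
    refine Finset.sum_congr rfl fun a _ => ?_
    congr 1
    ring
  have hψ1 : ∀ x, starRingEnd ℂ (ψ x) * ψ x = 1 := fun x => by
    rw [← AddChar.map_neg_eq_conj, ← AddChar.map_add_eq_mul]; simp
  -- The label `(a, b)` stands for a power of the clock times a shift by `b`. The three claims are
  -- completeness, Hilbert–Schmidt orthogonality and unitarity; the first two rest on orthogonality
  -- of characters.
  refine ⟨fun g i j => ψ (g.1 * e i) * if e i - e j = g.2 then 1 else 0, ?_, ?_, ?_⟩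
  · intro i j k l
    rw [Fintype.sum_prod_type]
    calc _ = (∑ a, starRingEnd ℂ (ψ (a * e i)) * ψ (a * e k)) *
          ∑ b, (if e i - e j = b then (1 : ℂ) else 0) * if e k - e l = b then 1 else 0 := by
          rw [Finset.sum_mul_sum]
          refine Finset.sum_congr rfl fun a _ => Finset.sum_congr rfl fun b _ => ?_
          simp only [map_mul, apply_ite (starRingEnd ℂ), map_one, map_zero]
          ring
      _ = _ := by
          rw [hψ]
          by_cases hik : i = k
          · subst hik; simp [eq_comm]
          · simp [hik]
  · rintro ⟨a, b⟩ ⟨a', b'⟩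
    have h1 : ∀ i, ∑ j, (ψ (a * e i) * if e i - e j = b then 1 else 0) *
        starRingEnd ℂ (ψ (a' * e i) * if e i - e j = b' then 1 else 0) =
        (starRingEnd ℂ (ψ (e i * a')) * ψ (e i * a)) * if b = b' then 1 else 0 := by
      intro i
      rw [← Equiv.sum_comp (e.symm.trans (Equiv.refl _))]
      simp only [Equiv.coe_trans, Equiv.coe_refl, Function.comp_apply, id, Equiv.apply_symm_apply]
      rw [Finset.sum_eq_single (e i - b)]
      · by_cases hb : b = b'
        · simp [hb, mul_comm]
        · simp [hb]
      · intro c _ hc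
        rw [if_neg (fun h => hc (by rw [← h]; ring))]; simp
      · simp
    simp only [h1]
    rw [← Finset.sum_mul, Equiv.sum_comp e (fun x => starRingEnd ℂ (ψ (x * a')) * ψ (x * a)), hψ]
    by_cases ha : a = a' <;> by_cases hb : b = b' <;> simp [ha, hb, eq_comm]
  · rintro ⟨a, b⟩ j l
    rw [Finset.sum_eq_single (e.symm (e j + b))]
    · by_cases hjl : j = l
      · subst hjl; simp [hψ1]
      · have : e j + b - e l ≠ b := fun h => hjl (e.injective (by linear_combination h))
        simp [hjl, this]
    · intro i _ hi
      have : e i - e j ≠ b := fun h => hi (by rw [← h]; simp)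
      simp [this]
    · simp

end ClockShift

/-! ### Bell registers and coherently controlled isometries -/

section Register

variable {d : ℕ} {K KL KR : Type*} [NormedAddCommGroup K] [InnerProductSpace ℂ K]
  [NormedAddCommGroup KL] [InnerProductSpace ℂ KL]
  [NormedAddCommGroup KR] [InnerProductSpace ℂ KR]

/-- The map `x ↦ x ⊗ e i ⊗ e j`. -/
def attachPair (K : Type*) [NormedAddCommGroup K] [InnerProductSpace ℂ K] (i j : Fin d) :
    K →ₗ[ℂ] (K ⊗[ℂ] EuclideanSpace ℂ (Fin d)) ⊗[ℂ] EuclideanSpace ℂ (Fin d) :=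
  (TensorProduct.mk ℂ _ _).flip (EuclideanSpace.basisFun (Fin d) ℂ j) ∘ₗ
    (TensorProduct.mk ℂ _ _).flip (EuclideanSpace.basisFun (Fin d) ℂ i)

theorem attachPair_apply (i j : Fin d) (x : K) :
    attachPair K i j x = (x ⊗ₜ[ℂ] EuclideanSpace.basisFun (Fin d) ℂ i) ⊗ₜ[ℂ]
      EuclideanSpace.basisFun (Fin d) ℂ j := rfl

/-- The map `x ↦ x ⊗ u`, where `u` is the normalized vectorization of the complex conjugate of the
matrix `w`. -/
def attachMatrix (K : Type*) [NormedAddCommGroup K] [InnerProductSpace ℂ K]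
    (w : Fin d → Fin d → ℂ) :
    K →ₗ[ℂ] (K ⊗[ℂ] EuclideanSpace ℂ (Fin d)) ⊗[ℂ] EuclideanSpace ℂ (Fin d) :=
  (((Real.sqrt d)⁻¹ : ℝ) : ℂ) • ∑ p : Fin d × Fin d, starRingEnd ℂ (w p.1 p.2) • attachPair K p.1 p.2

theorem inner_attachPair (i j k l : Fin d) (x y : K) :
    inner ℂ (attachPair K i j x) (attachPair K k l y) =
      if i = k ∧ j = l then inner ℂ x y else 0 := by
  simp only [attachPair_apply, TensorProduct.inner_tmul,
    orthonormal_iff_ite.mp (EuclideanSpace.basisFun (Fin d) ℂ).orthonormal]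
  by_cases h : i = k <;> by_cases h' : j = l <;> simp [h, h']

theorem ofReal_inv_sqrt_mul_self (d : ℕ) :
    (((Real.sqrt d)⁻¹ : ℝ) : ℂ) * (((Real.sqrt d)⁻¹ : ℝ) : ℂ) = (d : ℂ)⁻¹ := by
  rw [← Complex.ofReal_mul, ← mul_inv, Real.mul_self_sqrt (by positivity)]
  simp

theorem inner_smul_sum_conj_smul {ι F : Type*} [Fintype ι] [DecidableEq ι] [NormedAddCommGroup F]
    [InnerProductSpace ℂ F] (f g : ι → F) (c : ℂ)
    (h : ∀ p q, inner ℂ (f p) (g q) = if p = q then c else 0) (r : ℝ) (a b : ι → ℂ) :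
    inner ℂ ((r : ℂ) • ∑ p, starRingEnd ℂ (a p) • f p) ((r : ℂ) • ∑ p, starRingEnd ℂ (b p) • g p) =
      (r : ℂ) * r * (∑ p, a p * starRingEnd ℂ (b p)) * c := by
  simp only [inner_smul_left, inner_smul_right, sum_inner, inner_sum, h, Complex.conj_ofReal,
    Complex.conj_conj]
  simp only [Finset.mul_sum, Finset.sum_mul, mul_ite, mul_zero, Finset.sum_ite_eq',
    Finset.mem_univ, if_true]
  refine Finset.sum_congr rfl fun i _ => ?_
  ring

/-- Hilbert–Schmidt orthogonality of matrices becomes orthogonality of the attached registers, so an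
orthogonal unitary basis yields orthonormal Bell vectors. -/
theorem inner_attachMatrix (w w' : Fin d → Fin d → ℂ) (x y : K) :
    inner ℂ (attachMatrix K w x) (attachMatrix K w' y) =
      (d : ℂ)⁻¹ * (∑ i, ∑ j, w i j * starRingEnd ℂ (w' i j)) * inner ℂ x y := by
  have h := inner_smul_sum_conj_smul (fun p : Fin d × Fin d => attachPair K p.1 p.2 x)
    (fun p : Fin d × Fin d => attachPair K p.1 p.2 y) (inner ℂ x y)
    (fun p q => by simp only [inner_attachPair, Prod.ext_iff]) (Real.sqrt d)⁻¹
    (fun p => w p.1 p.2) (fun p => w' p.1 p.2)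
  rw [ofReal_inv_sqrt_mul_self, Fintype.sum_prod_type (fun p : Fin d × Fin d => _ * _)] at h
  rw [← h]
  simp only [attachMatrix, LinearMap.smul_apply, LinearMap.sum_apply]

theorem norm_eq_of_inner_self_eq {F G : Type*} [NormedAddCommGroup F] [InnerProductSpace ℂ F]
    [NormedAddCommGroup G] [InnerProductSpace ℂ G] {x : F} {y : G}
    (h : inner ℂ x x = inner ℂ y y) : ‖x‖ = ‖y‖ := by
  rw [@norm_eq_sqrt_re_inner ℂ, @norm_eq_sqrt_re_inner ℂ _ _ _ _ y, h]

theorem norm_attachMatrix [NeZero d] (w : Fin d → Fin d → ℂ)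
    (hw : ∑ i, ∑ j, w i j * starRingEnd ℂ (w i j) = d) (x : K) :
    ‖attachMatrix K w x‖ = ‖x‖ :=
  norm_eq_of_inner_self_eq (by
    refine (inner_attachMatrix w w x x).trans ?_
    rw [hw, inv_mul_cancel₀ (NeZero.ne _), one_mul])

theorem inner_sum_smul_sum_smul_of_orthogonal {ι F : Type*} [Fintype ι] [DecidableEq ι]
    [NormedAddCommGroup F] [InnerProductSpace ℂ F] (f g : ι → F) (c : ℂ)
    (h : ∀ p q, inner ℂ (f p) (g q) = if p = q then c else 0) (r : ℝ) :
    inner ℂ ((r : ℂ) • ∑ p, f p) ((r : ℂ) • ∑ p, g p) = (r : ℂ) * r * Fintype.card ι * c := by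
  simpa using inner_smul_sum_conj_smul f g c h r (fun _ => 1) (fun _ => 1)

/-- The isometry `x ↦ (1 / d) ∑ g, t g x ⊗ u g` that coherently applies the isometries `t g`. -/
def controlledIsometry [NeZero d] (w : ZMod d × ZMod d → Fin d → Fin d → ℂ)
    (hw : ∀ g h, ∑ i, ∑ j, w g i j * starRingEnd ℂ (w h i j) = if g = h then (d : ℂ) else 0)
    (t : ZMod d × ZMod d → K →ₗᵢ[ℂ] K) :
    K →ₗᵢ[ℂ] (K ⊗[ℂ] EuclideanSpace ℂ (Fin d)) ⊗[ℂ] EuclideanSpace ℂ (Fin d) :=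
  { (((d : ℝ)⁻¹ : ℝ) : ℂ) • ∑ g, attachMatrix K (w g) ∘ₗ (t g).toLinearMap with
    norm_map' := fun x => norm_eq_of_inner_self_eq (by
    have h := inner_sum_smul_sum_smul_of_orthogonal (fun g => attachMatrix K (w g) (t g x))
      (fun g => attachMatrix K (w g) (t g x)) (inner ℂ x x) (fun g g' => by
        rw [inner_attachMatrix, hw]
        by_cases hg : g = g'
        · subst hg
          rw [if_pos rfl, if_pos rfl, inv_mul_cancel₀ (NeZero.ne _), one_mul,
            LinearIsometry.inner_map_map]
        · simp [hg]) (d : ℝ)⁻¹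
    have hd : (d : ℂ) ≠ 0 := NeZero.ne _
    -- The `d²` orthogonal branches each have squared norm `‖x‖²`, which the prefactor `1 / d`
    -- compensates.
    have hone : (((d : ℝ)⁻¹ : ℝ) : ℂ) * ((d : ℝ)⁻¹ : ℝ) * Fintype.card (ZMod d × ZMod d) = 1 := by
      rw [Fintype.card_prod, ZMod.card]; push_cast; field_simp
    rw [hone, one_mul] at h
    rw [← h]
    simp only [LinearMap.smul_apply,
      LinearMap.sum_apply, LinearMap.comp_apply, LinearIsometry.coe_toLinearMap]) }

/-- The linear isometric automorphism of `ℂ ^ d` given by a unitary matrix. -/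
def matrixIsometryEquiv (w : Fin d → Fin d → ℂ)
    (hw : ∀ j l, ∑ i, starRingEnd ℂ (w i j) * w i l = if j = l then 1 else 0) :
    EuclideanSpace ℂ (Fin d) ≃ₗᵢ[ℂ] EuclideanSpace ℂ (Fin d) :=
  (((EuclideanSpace.basisFun (Fin d) ℂ).toBasis.constr ℂ fun p =>
      ∑ k, w k p • EuclideanSpace.basisFun (Fin d) ℂ k).isometryOfOrthonormal
    (v := (EuclideanSpace.basisFun (Fin d) ℂ).toBasis)
    (by simp) (by
      rw [orthonormal_iff_ite]
      intro j l
      simp only [Function.comp_apply, Module.Basis.constr_basis]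
      rw [(EuclideanSpace.basisFun (Fin d) ℂ).orthonormal.inner_sum, hw])).toLinearIsometryEquiv rfl

theorem matrixIsometryEquiv_apply (w : Fin d → Fin d → ℂ)
    (hw : ∀ j l, ∑ i, starRingEnd ℂ (w i j) * w i l = if j = l then 1 else 0) (p : Fin d) :
    matrixIsometryEquiv w hw (EuclideanSpace.basisFun (Fin d) ℂ p) =
      ∑ k, w k p • EuclideanSpace.basisFun (Fin d) ℂ k := by
  have := (EuclideanSpace.basisFun (Fin d) ℂ).toBasis.constr_basis ℂ (fun p =>
      ∑ k, w k p • EuclideanSpace.basisFun (Fin d) ℂ k) p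
  rw [OrthonormalBasis.coe_toBasis] at this
  exact this

end Register

/-! ### The teleportation identity -/

section Decoupling

variable {d : ℕ} {KL KR : Type*}
  [NormedAddCommGroup KL] [InnerProductSpace ℂ KL]
  [NormedAddCommGroup KR] [InnerProductSpace ℂ KR]

theorem tensorTensorTensorComm_tmul_basis (z : KL ⊗[ℂ] KR) (i j p q : Fin d) :
    TensorProduct.tensorTensorTensorComm ℂ _ _ _ _
      (TensorProduct.tensorTensorTensorComm ℂ _ _ _ _
        (z ⊗ₜ[ℂ] (EuclideanSpace.basisFun (Fin d) ℂ i ⊗ₜ[ℂ] EuclideanSpace.basisFun (Fin d) ℂ j)) ⊗ₜ[ℂ]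
        (EuclideanSpace.basisFun (Fin d) ℂ p ⊗ₜ[ℂ] EuclideanSpace.basisFun (Fin d) ℂ q)) =
      TensorProduct.map (attachPair KL i p) (attachPair KR j q) z := by
  induction z using TensorProduct.induction_on with
  | zero => simp
  | tmul x y =>
    simp only [TensorProduct.tensorTensorTensorComm_tmul, TensorProduct.map_tmul, attachPair_apply]
  | add x y hx hy => simp only [TensorProduct.add_tmul, map_add, hx, hy]

theorem map_sum_smul_left {ι : Type*} [Fintype ι] {X Y X' Y' : Type*} [AddCommGroup X] [Module ℂ X]
    [AddCommGroup Y] [Module ℂ Y] [AddCommGroup X'] [Module ℂ X'] [AddCommGroup Y'] [Module ℂ Y']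
    (f : ι → X →ₗ[ℂ] X') (g : ι → Y →ₗ[ℂ] Y') (a b : ι → ℂ) :
    TensorProduct.map (∑ i, a i • f i) (∑ j, b j • g j) =
      ∑ i, ∑ j, (a i * b j) • TensorProduct.map (f i) (g j) := by
  ext x y
  simp [TensorProduct.sum_tmul, TensorProduct.tmul_sum]
  rw [Finset.sum_comm]
  simp [Finset.smul_sum, ← TensorProduct.smul_tmul', smul_smul, mul_comm]

/-- Completeness inverts the Bell expansion: a product basis vector of the register is recovered
from the Bell vectors. The `√d` is `d`, from completeness, times their normalization `1 / √d`. -/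
theorem sum_smul_attachMatrix [NeZero d] (K : Type*) [NormedAddCommGroup K] [InnerProductSpace ℂ K]
    (w : ZMod d × ZMod d → Fin d → Fin d → ℂ)
    (hw : ∀ i j k l, ∑ g, starRingEnd ℂ (w g i j) * w g k l =
      if i = k ∧ j = l then (d : ℂ) else 0) (k p : Fin d) :
    ∑ g, w g k p • attachMatrix K (w g) = (Real.sqrt d : ℂ) • attachPair K k p := by
  have hd : (Real.sqrt d : ℂ) = (((Real.sqrt d)⁻¹ : ℝ) : ℂ) * d := by
    rw [← Complex.ofReal_natCast, ← Complex.ofReal_mul]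
    congr 1
    rw [eq_inv_mul_iff_mul_eq₀, Real.mul_self_sqrt (by positivity)]
    have : (0 : ℝ) < d := by exact_mod_cast Nat.pos_of_ne_zero (NeZero.ne d)
    positivity
  calc _ = (((Real.sqrt d)⁻¹ : ℝ) : ℂ) • ∑ q : Fin d × Fin d,
        (∑ g, starRingEnd ℂ (w g q.1 q.2) * w g k p) • attachPair K q.1 q.2 := by
        simp only [attachMatrix, Finset.smul_sum, Finset.sum_smul, smul_smul]
        rw [Finset.sum_comm]
        refine Finset.sum_congr rfl fun q _ => Finset.sum_congr rfl fun g _ => ?_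
        congr 1
        ring
    _ = _ := by
        rw [hd, mul_smul]
        congr 1
        rw [Finset.sum_eq_single (k, p)]
        · simp [hw]
        · rintro ⟨i, j⟩ - h
          rw [hw, if_neg, zero_smul]
          rintro ⟨rfl, rfl⟩
          exact h rfl
        · simp

/-- Teleportation. Projecting a reference factor and the matching factor of `φ` onto the Bell vector
of `w g` feeds `φ`, rotated by `w g`, into that input of `W`. Of the prefactor `d⁻²`, one `d⁻¹`
normalizes the maximally entangled vector and one `d^(-1/2)` comes from each of the two Bell
projections. -/
theorem decoupling_identity [NeZero d] (w : ZMod d × ZMod d → Fin d → Fin d → ℂ)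
    (hw : ∀ i j k l, ∑ g, starRingEnd ℂ (w g i j) * w g k l =
      if i = k ∧ j = l then (d : ℂ) else 0)
    (hu : ∀ g j l, ∑ i, starRingEnd ℂ (w g i j) * w g i l = if j = l then 1 else 0)
    (W : EuclideanSpace ℂ (Fin d) ⊗[ℂ] EuclideanSpace ℂ (Fin d) →ₗ[ℂ] KL ⊗[ℂ] KR)
    (φ : EuclideanSpace ℂ (Fin d) ⊗[ℂ] EuclideanSpace ℂ (Fin d)) :
    TensorProduct.tensorTensorTensorComm ℂ _ _ _ _
      (TensorProduct.tensorTensorTensorComm ℂ _ _ _ _ (choiState W) ⊗ₜ[ℂ] φ) =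
      ((d : ℂ)⁻¹ * (d : ℂ)⁻¹) • ∑ g, ∑ h,
        TensorProduct.map (attachMatrix KL (w g)) (attachMatrix KR (w h))
          (W (TensorProduct.map (matrixIsometryEquiv (w g) (hu g)).toLinearEquiv.toLinearMap
            (matrixIsometryEquiv (w h) (hu h)).toLinearEquiv.toLinearMap φ)) := by
  have hd : (d : ℂ) ≠ 0 := NeZero.ne _
  have hss : (Real.sqrt d : ℂ) * Real.sqrt d = d := by
    rw [← Complex.ofReal_mul, Real.mul_self_sqrt (by positivity)]; simp
  let L₁ := (TensorProduct.tensorTensorTensorComm ℂ _ _ _ _).toLinearMap ∘ₗ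
    TensorProduct.mk ℂ _ (EuclideanSpace ℂ (Fin d) ⊗[ℂ] EuclideanSpace ℂ (Fin d))
      (TensorProduct.tensorTensorTensorComm ℂ _ _ _ _ (choiState W))
  let L₂ := ((d : ℂ)⁻¹ * (d : ℂ)⁻¹) • ∑ g, ∑ h,
        TensorProduct.map (attachMatrix KL (w g)) (attachMatrix KR (w h)) ∘ₗ
          W ∘ₗ TensorProduct.map (matrixIsometryEquiv (w g) (hu g)).toLinearEquiv.toLinearMap
            (matrixIsometryEquiv (w h) (hu h)).toLinearEquiv.toLinearMap
  suffices h : L₁ = L₂ by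
    have := LinearMap.congr_fun h φ
    simpa only [L₁, L₂, LinearMap.smul_apply, LinearMap.sum_apply, LinearMap.comp_apply,
      LinearEquiv.coe_coe, TensorProduct.mk_apply] using this
  -- Both sides are linear in `φ`, so product basis vectors suffice.
  refine ((EuclideanSpace.basisFun (Fin d) ℂ).toBasis.tensorProduct
    (EuclideanSpace.basisFun (Fin d) ℂ).toBasis).ext fun ⟨p, q⟩ => ?_
  rw [Module.Basis.tensorProduct_apply, OrthonormalBasis.coe_toBasis]
  set b := EuclideanSpace.basisFun (Fin d) ℂ with hb
  have h₁ : L₁ (b p ⊗ₜ[ℂ] b q) = (d : ℂ)⁻¹ • ∑ k, ∑ l,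
      TensorProduct.map (attachPair KL k p) (attachPair KR l q) (W (b k ⊗ₜ[ℂ] b l)) := by
    have hs : ((Real.sqrt (Fintype.card (Fin d) * Fintype.card (Fin d)))⁻¹ : ℝ) = (d : ℝ)⁻¹ := by
      rw [Fintype.card_fin, Real.sqrt_mul_self (by positivity)]
    simp only [L₁, choiState, maxEntangled, hs, LinearMap.comp_apply, map_smul, map_sum,
      LinearMap.rTensor_tmul, LinearEquiv.coe_coe, LinearMap.smul_apply, LinearMap.sum_apply,
      TensorProduct.mk_apply, ← tensorTensorTensorComm_tmul_basis]
    rw [Complex.ofReal_inv, Complex.ofReal_natCast]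
  have h₂ : ∀ g h, TensorProduct.map (matrixIsometryEquiv (w g) (hu g)).toLinearEquiv.toLinearMap
      (matrixIsometryEquiv (w h) (hu h)).toLinearEquiv.toLinearMap (b p ⊗ₜ[ℂ] b q) =
      ∑ k, ∑ l, (w g k p * w h l q) • (b k ⊗ₜ[ℂ] b l) := by
    intro g h
    rw [TensorProduct.map_tmul]
    erw [matrixIsometryEquiv_apply, matrixIsometryEquiv_apply]
    simp only [TensorProduct.sum_tmul, TensorProduct.tmul_sum, TensorProduct.smul_tmul_smul]
    rw [Finset.sum_comm]
  have h₃ : ∀ k l, ∑ g, ∑ h, (w g k p * w h l q) •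
      TensorProduct.map (attachMatrix KL (w g)) (attachMatrix KR (w h)) =
      (d : ℂ) • TensorProduct.map (attachPair KL k p) (attachPair KR l q) := by
    intro k l
    rw [← map_sum_smul_left, sum_smul_attachMatrix KL w hw, sum_smul_attachMatrix KR w hw,
      TensorProduct.map_smul_left, TensorProduct.map_smul_right, smul_smul, hss]
  have h₄ : ∀ k l, ∑ g, ∑ h, (w g k p * w h l q) •
      TensorProduct.map (attachMatrix KL (w g)) (attachMatrix KR (w h)) (W (b k ⊗ₜ[ℂ] b l)) =
      (d : ℂ) • TensorProduct.map (attachPair KL k p) (attachPair KR l q) (W (b k ⊗ₜ[ℂ] b l)) := by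
    intro k l
    have := LinearMap.congr_fun (h₃ k l) (W (b k ⊗ₜ[ℂ] b l))
    simpa only [LinearMap.smul_apply, LinearMap.sum_apply] using this
  rw [h₁]
  simp only [L₂, LinearMap.smul_apply, LinearMap.sum_apply, LinearMap.comp_apply, h₂, map_sum,
    map_smul]
  calc _ = ((d : ℂ)⁻¹ * (d : ℂ)⁻¹) • ∑ k, ∑ l, ∑ g, ∑ h, (w g k p * w h l q) •
      TensorProduct.map (attachMatrix KL (w g)) (attachMatrix KR (w h)) (W (b k ⊗ₜ[ℂ] b l)) := by
        simp only [h₄, ← Finset.smul_sum, smul_smul]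
        congr 1
        field_simp
    _ = _ := by
        congr 1
        rw [Finset.sum_congr rfl fun k _ => Finset.sum_comm]
        rw [Finset.sum_comm]
        refine Finset.sum_congr rfl fun g _ => ?_
        rw [Finset.sum_congr rfl fun k _ => Finset.sum_comm]
        rw [Finset.sum_comm]

end Decoupling

/-! ### Regrouping tensor factors is isometric -/

section Regrouping

variable {A B C D : Type*}
  [NormedAddCommGroup A] [InnerProductSpace ℂ A] [NormedAddCommGroup B] [InnerProductSpace ℂ B]
  [NormedAddCommGroup C] [InnerProductSpace ℂ C] [NormedAddCommGroup D] [InnerProductSpace ℂ D]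

theorem norm_rightComm (x : (A ⊗[ℂ] B) ⊗[ℂ] C) : ‖TensorProduct.rightComm ℂ A B C x‖ = ‖x‖ := by
  have h : TensorProduct.rightComm ℂ A B C = TensorProduct.assoc ℂ A B C ≪≫ₗ
    TensorProduct.congr (LinearEquiv.refl ℂ A) (TensorProduct.comm ℂ B C) ≪≫ₗ
      (TensorProduct.assoc ℂ A C B).symm :=
    LinearEquiv.toLinearMap_injective (TensorProduct.ext_threefold fun _ _ _ => rfl)
  rw [h]
  refine ((TensorProduct.assocIsometry ℂ A C B).symm.norm_map _).trans ?_
  refine ((TensorProduct.commIsometry ℂ B C).toLinearIsometry.lTensor (E := A)).norm_map _ |>.trans ?_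
  exact TensorProduct.norm_assoc (𝕜 := ℂ) x

theorem norm_map_of_norm (f : A →ₗ[ℂ] B) (g : C →ₗ[ℂ] D) (hf : ∀ x, ‖f x‖ = ‖x‖)
    (hg : ∀ x, ‖g x‖ = ‖x‖) (x : A ⊗[ℂ] C) : ‖TensorProduct.map f g x‖ = ‖x‖ :=
  TensorProduct.norm_map (⟨f, hf⟩ : A →ₗᵢ[ℂ] B) (⟨g, hg⟩ : C →ₗᵢ[ℂ] D) x

theorem norm_tensorTensorTensorComm (x : (A ⊗[ℂ] B) ⊗[ℂ] (C ⊗[ℂ] D)) :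
    ‖TensorProduct.tensorTensorTensorComm ℂ A B C D x‖ = ‖x‖ := by
  have h : TensorProduct.tensorTensorTensorComm ℂ A B C D x =
    TensorProduct.assoc ℂ (A ⊗[ℂ] C) B D (TensorProduct.map
      (TensorProduct.rightComm ℂ A B C).toLinearMap LinearMap.id
      ((TensorProduct.assoc ℂ (A ⊗[ℂ] B) C D).symm x)) := rfl
  rw [h, TensorProduct.norm_assoc]
  have h2 := norm_map_of_norm (A := (A ⊗[ℂ] B) ⊗[ℂ] C) (B := (A ⊗[ℂ] C) ⊗[ℂ] B) (C := D) (D := D)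
    (TensorProduct.rightComm ℂ A B C).toLinearMap LinearMap.id norm_rightComm (fun _ => rfl)
    ((TensorProduct.assoc ℂ (A ⊗[ℂ] B) C D).symm x)
  have h3 := (TensorProduct.assocIsometry ℂ (A ⊗[ℂ] B) C D).symm.norm_map x
  exact h2.trans h3

end Regrouping

/-! ### The entropy formula at fixed size -/

section Decoupling

variable {d : ℕ} {KL KR : Type*}
  [NormedAddCommGroup KL] [InnerProductSpace ℂ KL]
  [NormedAddCommGroup KR] [InnerProductSpace ℂ KR]

theorem norm_smul_tensor {A B : Type*} [NormedAddCommGroup A] [InnerProductSpace ℂ A]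
    [NormedAddCommGroup B] [InnerProductSpace ℂ B] (c : ℂ) (v : A ⊗[ℂ] B) :
    ‖c • v‖ = ‖c‖ * ‖v‖ :=
  norm_smul c v

theorem norm_smul_sum_sub_smul_sum_le {A B ι : Type*} [Fintype ι] [NormedAddCommGroup A]
    [InnerProductSpace ℂ A] [NormedAddCommGroup B] [InnerProductSpace ℂ B] (c : ℂ)
    (x y : ι → ι → A ⊗[ℂ] B) {δ : ℝ} (h : ∀ i j, ‖x i j - y i j‖ ≤ δ) :
    ‖c • (∑ i, ∑ j, x i j) - c • ∑ i, ∑ j, y i j‖ ≤ ‖c‖ * (Fintype.card ι * (Fintype.card ι * δ)) := by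
  rw [← smul_sub, norm_smul]
  refine mul_le_mul_of_nonneg_left ?_ (norm_nonneg _)
  simp_rw [← Finset.sum_sub_distrib]
  refine (norm_sum_le_of_le _ fun i _ => norm_sum_le_of_le _ fun j _ => h i j).trans ?_
  simp

theorem norm_maxEntangled [NeZero d] : ‖maxEntangled (Fin d) (Fin d)‖ = 1 := by
  have hd : (0 : ℝ) < d := by exact_mod_cast Nat.pos_of_ne_zero (NeZero.ne d)
  have h := norm_sq_sum_tmul
    (fun p : Fin d × Fin d => EuclideanSpace.basisFun (Fin d) ℂ p.1 ⊗ₜ[ℂ]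
      EuclideanSpace.basisFun (Fin d) ℂ p.2) (by
      convert ((EuclideanSpace.basisFun (Fin d) ℂ).tensorProduct
        (EuclideanSpace.basisFun (Fin d) ℂ)).orthonormal using 2 with x
      exact (OrthonormalBasis.tensorProduct_apply' _ _ x).symm)
    (fun p : Fin d × Fin d => EuclideanSpace.basisFun (Fin d) ℂ p.1 ⊗ₜ[ℂ]
      EuclideanSpace.basisFun (Fin d) ℂ p.2)
  rw [Fintype.sum_prod_type] at h
  have h2 : ‖∑ i : Fin d, ∑ j : Fin d,
      (EuclideanSpace.basisFun (Fin d) ℂ i ⊗ₜ[ℂ] EuclideanSpace.basisFun (Fin d) ℂ j) ⊗ₜ[ℂ]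
        (EuclideanSpace.basisFun (Fin d) ℂ i ⊗ₜ[ℂ] EuclideanSpace.basisFun (Fin d) ℂ j)‖ = d := by
    rw [← sq_eq_sq₀ (norm_nonneg _) hd.le, h]
    simp [TensorProduct.norm_tmul, sq]
  rw [maxEntangled, norm_smul_tensor, h2, Fintype.card_fin, Real.sqrt_mul_self hd.le, Complex.norm_real,
    norm_inv, Real.norm_of_nonneg hd.le, inv_mul_cancel₀ hd.ne']

theorem norm_choiState_le [NeZero d]
    (W : EuclideanSpace ℂ (Fin d) ⊗[ℂ] EuclideanSpace ℂ (Fin d) →ₗ[ℂ] KL ⊗[ℂ] KR)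
    (hW : ∀ x, ‖W x‖ ≤ ‖x‖) : ‖choiState W‖ ≤ 1 := by
  let W' := W.mkContinuous 1 (by simpa using hW)
  have h1 : ‖W'‖ ≤ 1 := W.mkContinuous_norm_le zero_le_one _
  have h2 := (W'.rTensor (EuclideanSpace ℂ (Fin d) ⊗[ℂ] EuclideanSpace ℂ (Fin d))).le_opNorm
    (maxEntangled (Fin d) (Fin d))
  rw [norm_maxEntangled, mul_one] at h2
  exact h2.trans ((ContinuousLinearMap.norm_rTensor_le _ W').trans h1)

theorem controlledIsometry_toLinearMap {K : Type*} [NormedAddCommGroup K] [InnerProductSpace ℂ K]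
    [NeZero d] (w : ZMod d × ZMod d → Fin d → Fin d → ℂ)
    (hw : ∀ g h, ∑ i, ∑ j, w g i j * starRingEnd ℂ (w h i j) = if g = h then (d : ℂ) else 0)
    (t : ZMod d × ZMod d → K →ₗᵢ[ℂ] K) :
    (controlledIsometry w hw t).toLinearMap =
      ∑ g, (d : ℂ)⁻¹ • (attachMatrix K (w g) ∘ₗ (t g).toLinearMap) := by
  have h : (controlledIsometry w hw t).toLinearMap =
    (((d : ℝ)⁻¹ : ℝ) : ℂ) • ∑ g, attachMatrix K (w g) ∘ₗ (t g).toLinearMap := rfl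
  rw [h, Finset.smul_sum, Complex.ofReal_inv, Complex.ofReal_natCast]

theorem controlledIsometry_map [NeZero d] (w : ZMod d × ZMod d → Fin d → Fin d → ℂ)
    (hw : ∀ g h, ∑ i, ∑ j, w g i j * starRingEnd ℂ (w h i j) = if g = h then (d : ℂ) else 0)
    (tL : ZMod d × ZMod d → KL →ₗᵢ[ℂ] KL) (tR : ZMod d × ZMod d → KR →ₗᵢ[ℂ] KR)
    (ψ : KL ⊗[ℂ] KR) :
    TensorProduct.map (controlledIsometry w hw tL).toLinearMap
      (controlledIsometry w hw tR).toLinearMap ψ =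
      ((d : ℂ)⁻¹ * (d : ℂ)⁻¹) • ∑ g, ∑ h,
        TensorProduct.map (attachMatrix KL (w g)) (attachMatrix KR (w h))
          (TensorProduct.map (tL g).toLinearMap (tR h).toLinearMap ψ) := by
  rw [controlledIsometry_toLinearMap, controlledIsometry_toLinearMap, map_sum_smul_left]
  simp only [← Finset.smul_sum, LinearMap.smul_apply, LinearMap.sum_apply,
    TensorProduct.map_comp, LinearMap.comp_apply]

/-- The triangle inequality suffices: each branch moves by at most `δ` because `JL i ⊗ JR j` is
isometric. `TL ⊗ TR` is a product of local isometries, so its image of `ψ` has the entropy and norm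
of `ψ`. -/
theorem abs_entropy_sub_le_of_coherent_sum {A B ι : Type*} [Fintype ι] [NormedAddCommGroup A]
    [InnerProductSpace ℂ A] [FiniteDimensional ℂ A] [NormedAddCommGroup B] [InnerProductSpace ℂ B]
    [FiniteDimensional ℂ B] [FiniteDimensional ℂ KL] [FiniteDimensional ℂ KR]
    (c : ℂ) (JL : ι → KL →ₗ[ℂ] A) (JR : ι → KR →ₗ[ℂ] B) (hJL : ∀ i x, ‖JL i x‖ = ‖x‖)
    (hJR : ∀ i x, ‖JR i x‖ = ‖x‖) (TL : KL →ₗ[ℂ] A) (TR : KR →ₗ[ℂ] B) (hTL : ∀ x, ‖TL x‖ = ‖x‖)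
    (hTR : ∀ x, ‖TR x‖ = ‖x‖) (x y : ι → ι → KL ⊗[ℂ] KR) {δ ε : ℝ}
    (hxy : ∀ i j, ‖x i j - y i j‖ ≤ δ) (hε : ‖c‖ * (Fintype.card ι * (Fintype.card ι * δ)) = ε)
    {v : A ⊗[ℂ] B} {ψ : KL ⊗[ℂ] KR}
    (hv : v = c • ∑ i, ∑ j, TensorProduct.map (JL i) (JR j) (x i j))
    (hT : TensorProduct.map TL TR ψ = c • ∑ i, ∑ j, TensorProduct.map (JL i) (JR j) (y i j))
    {r s a : ℝ} (hS : leftEntropy v = r + a ^ 2 * s ∧ ‖v‖ = a) (ha : a ≤ 1)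
    (hψ : ‖ψ‖ ≤ 1) (hε1 : 2 * ε ≤ 1) :
    |r + a ^ 2 * s - leftEntropy ψ| ≤ 2 * ε * Real.log (Module.finrank ℂ A) +
      Real.negMulLog (2 * ε) + 2 * (2 * ε) ∧ ‖ψ‖ - a ≤ ε := by
  obtain ⟨hS, hN⟩ := hS
  have hdist : ‖v - TensorProduct.map TL TR ψ‖ ≤ ε := by
    rw [hv, hT, ← hε]
    refine norm_smul_sum_sub_smul_sum_le _ _ _ fun i j => ?_
    rw [← map_sub]
    exact (norm_map_of_norm _ _ (hJL i) (hJR j) _).trans_le (hxy i j)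
  have hTn := norm_map_of_norm TL TR hTL hTR ψ
  have hTS : leftEntropy (TensorProduct.map TL TR ψ) = leftEntropy ψ :=
    leftEntropy_map (⟨TL, hTL⟩ : KL →ₗᵢ[ℂ] A) (⟨TR, hTR⟩ : KR →ₗᵢ[ℂ] B) ψ
  constructor
  · rw [← hS, ← hTS]
    exact abs_leftEntropy_sub_le (hN.trans_le ha) (hTn.trans_le hψ) hε1 hdist
  · rw [← hN, ← hTn]
    exact (norm_sub_norm_le _ _).trans ((norm_sub_rev _ _).trans_le hdist)

/-- The entropy formula for a code of fixed size, with an explicit error: if the code `W` maps all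
`(U ⊗ U') φ` close to product unitary rotations of a single vector `ψ`, the entropy of `ψ` is close
to the sum of the entropy of `φ` and the area term of `W`. -/
theorem abs_leftEntropy_add_areaTerm_sub_le [NeZero d] [FiniteDimensional ℂ KL]
    [FiniteDimensional ℂ KR]
    (W : EuclideanSpace ℂ (Fin d) ⊗[ℂ] EuclideanSpace ℂ (Fin d) →ₗ[ℂ] KL ⊗[ℂ] KR)
    (hW : ∀ x, ‖W x‖ ≤ ‖x‖) (φ : EuclideanSpace ℂ (Fin d) ⊗[ℂ] EuclideanSpace ℂ (Fin d))
    (hφ : ‖φ‖ = 1) (ψ : KL ⊗[ℂ] KR) (hψ : ‖ψ‖ ≤ 1) (δ : ℝ) (hδ : 2 * (d ^ 2 * δ) ≤ 1)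
    (tL : (EuclideanSpace ℂ (Fin d) ≃ₗᵢ[ℂ] EuclideanSpace ℂ (Fin d)) → KL →ₗᵢ[ℂ] KL)
    (tR : (EuclideanSpace ℂ (Fin d) ≃ₗᵢ[ℂ] EuclideanSpace ℂ (Fin d)) → KR →ₗᵢ[ℂ] KR)
    (h : ∀ U U' : EuclideanSpace ℂ (Fin d) ≃ₗᵢ[ℂ] EuclideanSpace ℂ (Fin d),
      ‖W (TensorProduct.map U.toLinearEquiv.toLinearMap U'.toLinearEquiv.toLinearMap φ) -
        TensorProduct.map (tL U).toLinearMap (tR U').toLinearMap ψ‖ ≤ δ) :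
    |leftEntropy φ + areaTerm W - leftEntropy ψ| ≤
      2 * (d ^ 2 * δ) * Real.log (Module.finrank ℂ KL * d * d) + Real.negMulLog (2 * (d ^ 2 * δ)) +
        2 * (2 * (d ^ 2 * δ)) + 2 * (1 - ‖W φ‖ + δ + d ^ 2 * δ) * d := by
  have hd : (0 : ℝ) < d := by exact_mod_cast Nat.pos_of_ne_zero (NeZero.ne d)
  obtain ⟨w, hw, hw', hu⟩ := exists_orthogonal_unitary_basis d
  have hSN := leftEntropy_tensorTensorTensorComm_tmul
    (TensorProduct.tensorTensorTensorComm ℂ KL KR _ _ (choiState W)) φ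
  set a := ‖TensorProduct.tensorTensorTensorComm ℂ KL KR _ _ (choiState W)‖
  have ha : a ≤ 1 := (norm_tensorTensorTensorComm _).trans_le (norm_choiState_le W hW)
  have ha0 : 0 ≤ a := norm_nonneg _
  rw [hφ, mul_one, one_pow, one_mul] at hSN
  -- There are `d⁴` branches, each with weight `d⁻²`.
  have hε : ‖(d : ℂ)⁻¹ * (d : ℂ)⁻¹‖ * (Fintype.card (ZMod d × ZMod d) *
      (Fintype.card (ZMod d × ZMod d) * δ)) = d ^ 2 * δ := by
    rw [Fintype.card_prod, ZMod.card, norm_mul, norm_inv, Complex.norm_natCast]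
    push_cast
    field_simp
  have key := abs_entropy_sub_le_of_coherent_sum
    (A := (KL ⊗[ℂ] EuclideanSpace ℂ (Fin d)) ⊗[ℂ] EuclideanSpace ℂ (Fin d))
    (B := (KR ⊗[ℂ] EuclideanSpace ℂ (Fin d)) ⊗[ℂ] EuclideanSpace ℂ (Fin d))
    (ψ := ψ) (r := areaTerm W) (s := leftEntropy φ) (a := a)
    (v := TensorProduct.tensorTensorTensorComm ℂ _ _ _ _
      (TensorProduct.tensorTensorTensorComm ℂ _ _ _ _ (choiState W) ⊗ₜ[ℂ] φ))
    ((d : ℂ)⁻¹ * (d : ℂ)⁻¹) (fun g => attachMatrix KL (w g)) (fun g => attachMatrix KR (w g))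
    (fun g => norm_attachMatrix (w g) (by simp [hw']))
    (fun g => norm_attachMatrix (w g) (by simp [hw']))
    (controlledIsometry w hw' fun g => tL (matrixIsometryEquiv (w g) (hu g))).toLinearMap
    (controlledIsometry w hw' fun g => tR (matrixIsometryEquiv (w g) (hu g))).toLinearMap
    (controlledIsometry w hw' fun g => tL (matrixIsometryEquiv (w g) (hu g))).norm_map
    (controlledIsometry w hw' fun g => tR (matrixIsometryEquiv (w g) (hu g))).norm_map
    (fun g g' => W (TensorProduct.map
      (matrixIsometryEquiv (w g) (hu g)).toLinearEquiv.toLinearMap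
      (matrixIsometryEquiv (w g') (hu g')).toLinearEquiv.toLinearMap φ))
    (fun g g' => TensorProduct.map (tL (matrixIsometryEquiv (w g) (hu g))).toLinearMap
      (tR (matrixIsometryEquiv (w g') (hu g'))).toLinearMap ψ)
    (fun g g' => h (matrixIsometryEquiv (w g) (hu g)) (matrixIsometryEquiv (w g') (hu g')))
    hε
  have key2 := fun hT => key (decoupling_identity w hw hu W φ) hT
  have key3 := key2 (controlledIsometry_map w hw' _ _ ψ)
  obtain ⟨hfan, h2⟩ := key3 hSN ha hψ hδ
  rw [Module.finrank_tensorProduct, Module.finrank_tensorProduct,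
    finrank_euclideanSpace_fin] at hfan
  push_cast at hfan
  have hΦ : |leftEntropy φ| ≤ d := by simpa using abs_leftEntropy_le hφ.le
  -- Reconstruction at the identity compares `ψ` with `W φ` itself.
  have h1 : ‖W φ‖ - ‖ψ‖ ≤ δ := by
    have h0 := h (LinearIsometryEquiv.refl ℂ _) (LinearIsometryEquiv.refl ℂ _)
    have h0' := TensorProduct.norm_map (tL (LinearIsometryEquiv.refl ℂ _))
      (tR (LinearIsometryEquiv.refl ℂ _)) ψ
    have hid : TensorProduct.map
      (LinearIsometryEquiv.refl ℂ (EuclideanSpace ℂ (Fin d))).toLinearEquiv.toLinearMap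
      (LinearIsometryEquiv.refl ℂ (EuclideanSpace ℂ (Fin d))).toLinearEquiv.toLinearMap φ = φ :=
      LinearMap.congr_fun TensorProduct.map_id φ
    rw [hid] at h0
    rw [← h0']
    exact (norm_sub_norm_le _ _).trans h0
  -- Here `a ≥ ‖ψ‖ - d² δ ≥ ‖W φ‖ - δ - d² δ`, and `1 - a² ≤ 2 (1 - a)` because `a ≤ 1`.
  have h3 : 1 - a ^ 2 ≤ 2 * (1 - ‖W φ‖ + δ + d ^ 2 * δ) := by
    nlinarith [ha0]
  have h4 : 0 ≤ 1 - a ^ 2 := by nlinarith [ha0]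
  calc |leftEntropy φ + areaTerm W - leftEntropy ψ|
      = |(areaTerm W + a ^ 2 * leftEntropy φ - leftEntropy ψ) +
          (1 - a ^ 2) * leftEntropy φ| := by congr 1; ring
    _ ≤ |areaTerm W + a ^ 2 * leftEntropy φ - leftEntropy ψ| +
          |(1 - a ^ 2) * leftEntropy φ| := abs_add_le _ _
    _ ≤ _ := by
        refine add_le_add hfan ?_
        rw [abs_mul, abs_of_nonneg h4]
        exact mul_le_mul h3 hΦ (abs_nonneg _) (h4.trans h3)

end Decoupling

/-! ### Matrix units in a finite-dimensional factor -/

section Factor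

variable {H : Type*} [NormedAddCommGroup H] [InnerProductSpace ℂ H] [CompleteSpace H]

/-- On a finite spectrum every function is continuous, so the continuous functional calculus already
yields spectral projections. -/
theorem finite_spectrum_of_isIntegral {A : Type*} [Ring A] [Algebra ℂ A] {y : A}
    (hy : IsIntegral ℂ y) : (spectrum ℂ y).Finite := by
  obtain ⟨P, hP, hPy⟩ := hy
  rw [← Polynomial.aeval_def] at hPy
  refine (P.roots.toFinset.finite_toSet).subset fun t ht => ?_
  have h1 := spectrum.subset_polynomial_aeval y P ⟨t, ht, rfl⟩
  rw [hPy] at h1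
  have : Nontrivial A := by
    by_contra h
    rw [not_nontrivial_iff_subsingleton] at h
    exact ht (isUnit_of_subsingleton _)
  rw [spectrum.zero_eq, Set.mem_singleton_iff] at h1
  simpa [hP.ne_zero] using h1

theorem VonNeumannAlgebra.cfc_mem (N : VonNeumannAlgebra H) {y : H →L[ℂ] H} (hy : y ∈ N)
    (hsa : IsSelfAdjoint y) (f : ℂ → ℂ) : cfc f y ∈ N := by
  rw [← N.commutant_commutant, VonNeumannAlgebra.mem_commutant_iff]
  intro b hb
  have h : Commute y b := VonNeumannAlgebra.mem_commutant_iff.1 hb y hy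
  exact (hsa.commute_cfc h f).symm.eq

theorem VonNeumannAlgebra.smul_mem (N : VonNeumannAlgebra H) (c : ℂ) {y : H →L[ℂ] H}
    (hy : y ∈ N) : c • y ∈ N :=
  N.toStarSubalgebra.smul_mem hy c

theorem VonNeumannAlgebra.isIntegral (N : VonNeumannAlgebra H)
    [FiniteDimensional ℂ N.toStarSubalgebra] {y : H →L[ℂ] H} (hy : y ∈ N) : IsIntegral ℂ y :=
  (Algebra.IsIntegral.isIntegral (R := ℂ) (⟨y, hy⟩ : N.toStarSubalgebra)).map
    N.toStarSubalgebra.subtype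

/-- The spectral projection of `y` at a nonzero eigenvalue `t` lies below `p`, hence equals `p` by
minimality, and then `y = y p = t p`. With no such eigenvalue, `y = 0`. -/
theorem eq_smul_of_mem_corner_of_isSelfAdjoint (N : VonNeumannAlgebra H)
    [FiniteDimensional ℂ N.toStarSubalgebra] {p : H →L[ℂ] H} (hp : IsStarProjection p)
    (hmin : ∀ q ∈ N, IsStarProjection q → q ≤ p → q = 0 ∨ q = p) {y : H →L[ℂ] H} (hy : y ∈ N)
    (hsa : IsSelfAdjoint y) (hpy : p * y = y) : ∃ c : ℂ, y = c • p := by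
  have hfin := finite_spectrum_of_isIntegral (N.isIntegral hy)
  have hcont : ∀ f : ℂ → ℂ, ContinuousOn f (spectrum ℂ y) := fun f => hfin.continuousOn f
  have hn : IsStarNormal y := hsa.isStarNormal
  by_cases hz : ∀ t ∈ spectrum ℂ y, t = 0
  · refine ⟨0, ?_⟩
    rw [zero_smul, ← cfc_id ℂ y, cfc_congr (f := id) (g := fun _ => (0 : ℂ)) (fun t ht => hz t ht)]
    simp
  push Not at hz
  obtain ⟨t, ht, ht0⟩ := hz
  let f : ℂ → ℂ := fun s => if s = t then 1 else 0
  set q := cfc f y with hq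
  have hqN : q ∈ N := N.cfc_mem hy hsa f
  have hqp : IsStarProjection q := by
    constructor
    · rw [IsIdempotentElem, hq, ← cfc_mul f f y (hcont _) (hcont _)]
      congr 1
      ext s
      by_cases hs : s = t <;> simp [f, hs]
    · rw [IsSelfAdjoint, hq, ← cfc_star]
      congr 1
      ext s
      by_cases hs : s = t <;> simp [f, hs]
  have hyq : y * q = t • q := by
    rw [hq, ← cfc_const_mul t f y (hcont _)]
    nth_rewrite 1 [← cfc_id ℂ y]
    rw [← cfc_mul id f y (hcont _) (hcont _)]
    congr 1
    ext s
    by_cases hs : s = t <;> simp [f, hs]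
  have hq0 : q ≠ 0 := by
    intro h0
    have hm := cfc_map_spectrum f y hn (hcont _)
    rw [← hq, h0] at hm
    have h1 : (1 : ℂ) ∈ spectrum ℂ (0 : H →L[ℂ] H) := by
      rw [hm]; exact ⟨t, ht, by simp [f]⟩
    have : Nontrivial (H →L[ℂ] H) := by
      by_contra h
      rw [not_nontrivial_iff_subsingleton] at h
      exact ht (isUnit_of_subsingleton _)
    rw [spectrum.zero_eq] at h1
    exact one_ne_zero h1
  have hpq : p * q = q := by
    have : q = t⁻¹ • (y * q) := by rw [hyq, smul_smul, inv_mul_cancel₀ ht0, one_smul]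
    rw [this, mul_smul_comm, ← mul_assoc, hpy]
  have hqeq := (hmin q hqN hqp (hqp.le_of_mul_eq_right hp hpq)).resolve_left hq0
  refine ⟨t, ?_⟩
  rw [← hqeq, ← hyq, hqeq]
  have := congrArg star hpy
  rw [star_mul, hsa.star_eq, hp.isSelfAdjoint.star_eq] at this
  exact this.symm

theorem exists_corner_eq_smul (N : VonNeumannAlgebra H)
    [FiniteDimensional ℂ N.toStarSubalgebra] {p : H →L[ℂ] H} (hpN : p ∈ N)
    (hp : IsStarProjection p)
    (hmin : ∀ q ∈ N, IsStarProjection q → q ≤ p → q = 0 ∨ q = p) {x : H →L[ℂ] H} (hx : x ∈ N) :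
    ∃ c : ℂ, p * x * p = c • p := by
  have hpp : p * p = p := hp.isIdempotentElem
  have hps : star p = p := hp.isSelfAdjoint.star_eq
  set y := p * x * p with hy
  have hyN : y ∈ N := mul_mem (mul_mem hpN hx) hpN
  have hpy : p * y = y := by rw [hy, ← mul_assoc, ← mul_assoc, hpp]
  have hpys : p * star y = star y := by
    rw [hy, star_mul, star_mul, hps, ← mul_assoc, hpp]
  have hsN : star y ∈ N := star_mem hyN
  obtain ⟨a, ha⟩ := eq_smul_of_mem_corner_of_isSelfAdjoint N hp hmin (y := y + star y)
    (add_mem hyN hsN) (IsSelfAdjoint.add_star_self y) (by rw [mul_add, hpy, hpys])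
  obtain ⟨b, hb⟩ := eq_smul_of_mem_corner_of_isSelfAdjoint N hp hmin
    (y := Complex.I • (y - star y)) (N.smul_mem _ (sub_mem hyN hsN))
    (by rw [IsSelfAdjoint, star_smul, star_sub, star_star, RCLike.star_def, Complex.conj_I,
          neg_smul, ← smul_neg, neg_sub])
    (by rw [mul_smul_comm, mul_sub, hpy, hpys])
  -- Recombines `y` from the self-adjoint elements `y + y*` and `i (y - y*)`.
  refine ⟨(1 / 2 : ℂ) * (a - Complex.I * b), ?_⟩
  rw [mul_smul, sub_smul, mul_smul, ← ha, ← hb, smul_smul, Complex.I_mul_I]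
  module

/-- Since the corner `p N p` is scalar, `x* y` for `x, y ∈ N p` is a multiple of `p`, namely `⟨x ξ,
y ξ⟩ p` for a unit vector `ξ` fixed by `p`. An orthonormal basis of `N ξ` thus lifts to the frame.
-/
theorem exists_orthogonal_frame (N : VonNeumannAlgebra H)
    [FiniteDimensional ℂ N.toStarSubalgebra] {p : H →L[ℂ] H} (hpN : p ∈ N)
    (hp : IsStarProjection p) (hp0 : p ≠ 0)
    (hmin : ∀ q ∈ N, IsStarProjection q → q ≤ p → q = 0 ∨ q = p) :
    ∃ (n : ℕ) (e : Fin n → (H →L[ℂ] H)), (∀ i, e i ∈ N) ∧ (∀ i, e i * p = e i) ∧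
      (∀ i j, star (e i) * e j = if i = j then p else 0) ∧
      ∀ y ∈ N, ∃ c : Fin n → ℂ, y * p = ∑ i, c i • e i := by
  have hpp : p * p = p := hp.isIdempotentElem
  have hps : star p = p := hp.isSelfAdjoint.star_eq
  obtain ⟨ξ, hξ, hpξ⟩ : ∃ ξ : H, ‖ξ‖ = 1 ∧ p ξ = ξ := by
    obtain ⟨η, hη⟩ : ∃ η, p η ≠ 0 := by
      by_contra! h
      exact hp0 (ContinuousLinearMap.ext h)
    refine ⟨((‖p η‖⁻¹ : ℝ) : ℂ) • p η, ?_, ?_⟩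
    · rw [norm_smul, Complex.norm_real, norm_inv, norm_norm, inv_mul_cancel₀ (norm_ne_zero_iff.2 hη)]
    · rw [map_smul, ← mul_apply_eq_comp, hpp]
  have hinner : ∀ x y : H →L[ℂ] H, ∀ c : ℂ, p * (star x * y) * p = c • p →
      c = inner ℂ (x ξ) (y ξ) := by
    intro x y c h
    have h1 : inner ℂ ξ ((p * (star x * y) * p) ξ) = inner ℂ (x ξ) (y ξ) := by
      simp only [mul_apply_eq_comp, hpξ]
      rw [← ContinuousLinearMap.adjoint_inner_left, ← ContinuousLinearMap.star_eq_adjoint, hps, hpξ,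
        ContinuousLinearMap.star_eq_adjoint, ContinuousLinearMap.adjoint_inner_right]
    rw [← h1, h]
    simp [hpξ, inner_self_eq_norm_sq_to_K, hξ]
  have hcorner : ∀ x ∈ N, ∀ y ∈ N, p * (star x * y) * p = (inner ℂ (x ξ) (y ξ) : ℂ) • p := by
    intro x hx y hy
    obtain ⟨c, hc⟩ := exists_corner_eq_smul N hpN hp hmin (mul_mem (star_mem hx) hy)
    rw [hc, hinner x y c hc]
  let L : N.toStarSubalgebra →ₗ[ℂ] H :=
    { toFun := fun x => (x : H →L[ℂ] H) ξ
      map_add' := fun _ _ => rfl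
      map_smul' := fun _ _ => rfl }
  let b := stdOrthonormalBasis ℂ (LinearMap.range L)
  have hx : ∀ i, ∃ x ∈ N, x ξ = b i := fun i => by
    obtain ⟨x, hx⟩ := (b i).2
    exact ⟨x, x.2, hx⟩
  choose x hxN hxb using hx
  have hee : ∀ i j, star (x i * p) * (x j * p) = if i = j then p else 0 := by
    intro i j
    rw [star_mul, hps, mul_assoc, ← mul_assoc (star (x i)), ← mul_assoc, hcorner _ (hxN i) _ (hxN j),
      hxb, hxb, ← Submodule.coe_inner, orthonormal_iff_ite.mp b.orthonormal]
    split_ifs <;> simp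
  have hexp : ∀ y ∈ N, y * p = ∑ i, (inner ℂ (b i : H) (y ξ) : ℂ) • (x i * p) := by
    intro y hy
    rw [← sub_eq_zero]
    set z := y * p - ∑ i, (inner ℂ (b i : H) (y ξ) : ℂ) • (x i * p) with hz
    have hzN : z ∈ N := sub_mem (mul_mem hy hpN)
      (sum_mem fun i _ => N.smul_mem _ (mul_mem (hxN i) hpN))
    have hzp : z * p = z := by
      rw [hz, sub_mul, Finset.sum_mul, mul_assoc, hpp]
      simp only [smul_mul_assoc, mul_assoc, hpp]
    have hzξ : z ξ = 0 := by
      have hyr : y ξ ∈ LinearMap.range L := ⟨⟨y, hy⟩, rfl⟩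
      have h1 := congrArg Subtype.val (b.sum_repr' ⟨y ξ, hyr⟩)
      simp only [Submodule.coe_sum, Submodule.coe_smul, Submodule.coe_inner] at h1
      simp only [hz, sub_apply, mul_apply_eq_comp, hpξ,
        sum_apply, smul_apply, hxb]
      rw [h1, sub_self]
    -- The remainder `z` lies in `N p` and kills `ξ`, so `z* z = ‖z ξ‖² p = 0`.
    have h2 := hcorner z hzN z hzN
    rw [hzξ, inner_zero_left, zero_smul, ← mul_assoc, mul_assoc, hzp] at h2
    have h3 : star z * z = 0 := by
      nth_rewrite 1 [← hzp]
      rw [star_mul, hps, h2]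
    exact CStarRing.star_mul_self_eq_zero_iff z |>.1 h3
  exact ⟨_, fun i => x i * p, fun i => mul_mem (hxN i) hpN, fun i => by rw [mul_assoc, hpp], hee,
    fun y hy => ⟨_, hexp y hy⟩⟩

/-- A finite-dimensional type I factor has a system of matrix units `e i * star (e j)`. -/
theorem exists_matrixUnits (N : VonNeumannAlgebra H)
    [FiniteDimensional ℂ N.toStarSubalgebra] (hN : IsFactor N) {p : H →L[ℂ] H} (hpN : p ∈ N)
    (hp : IsStarProjection p) (hp0 : p ≠ 0)
    (hmin : ∀ q ∈ N, IsStarProjection q → q ≤ p → q = 0 ∨ q = p) :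
    ∃ (n : ℕ) (e : Fin n → (H →L[ℂ] H)), (∀ i, e i ∈ N) ∧ (∀ i, e i * p = e i) ∧
      (∀ i j, star (e i) * e j = if i = j then p else 0) ∧ ∑ i, e i * star (e i) = 1 := by
  obtain ⟨n, e, heN, hep, hee, hexp⟩ := exists_orthogonal_frame N hpN hp hp0 hmin
  refine ⟨n, e, heN, hep, hee, ?_⟩
  set q := ∑ i, e i * star (e i) with hq
  have hqe : ∀ j, q * e j = e j := by
    intro j
    rw [hq, Finset.sum_mul]
    simp only [mul_assoc, hee]
    simp [hep]
  have hqp : ∀ y ∈ N, q * (y * p) = y * p := by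
    intro y hy
    obtain ⟨c, hc⟩ := hexp y hy
    rw [hc, Finset.mul_sum]
    simp only [mul_smul_comm, hqe]
  have hqN : q ∈ N := sum_mem fun i _ => mul_mem (heN i) (star_mem (heN i))
  have hqs : star q = q := by simp [hq, star_sum]
  have hep_assoc : ∀ i (z : H →L[ℂ] H), e i * (p * z) = e i * z := fun i z => by
    rw [← mul_assoc, hep]
  have hqyq : ∀ y ∈ N, q * (y * q) = y * q := by
    intro y hy
    rw [show y * q = ∑ i, (y * e i * p) * star (e i) by
      simp only [hq, Finset.mul_sum, mul_assoc, hep_assoc], Finset.mul_sum]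
    refine Finset.sum_congr rfl fun i _ => ?_
    rw [← mul_assoc q, hqp _ (mul_mem hy (heN i))]
  -- The range of `q` is invariant under `N`; invariance under adjoints as well makes `q` central.
  -- It is then a scalar, and `q p = p` forces it to be `1`.
  have hqc : q ∈ N.commutant := by
    rw [VonNeumannAlgebra.mem_commutant_iff]
    intro y hy
    have h1 := congrArg star (hqyq (star y) (star_mem hy))
    simp only [star_mul, star_star, hqs] at h1
    rw [← hqyq y hy, ← h1, mul_assoc]
  obtain ⟨c, hc⟩ := hN q hqN hqc
  have hc1 : c = 1 := by
    have h1 := hqp 1 (one_mem N)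
    rw [one_mul, hc, smul_mul_assoc, one_mul] at h1
    exact smul_left_injective ℂ hp0 (h1.trans (one_smul ℂ p).symm)
  rw [hc, hc1, one_smul]

end Factor

/-! ### Factorization of the regulated code subspace -/

section Factor

variable {H : Type*} [NormedAddCommGroup H] [InnerProductSpace ℂ H] [CompleteSpace H]

theorem finrank_eq_sq_of_matrixUnits (N : VonNeumannAlgebra H)
    [FiniteDimensional ℂ N.toStarSubalgebra] {p : H →L[ℂ] H} (hp0 : p ≠ 0)
    (hcorner : ∀ x ∈ N, ∃ c : ℂ, p * x * p = c • p) (hps : star p = p)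
    {n : ℕ} {e : Fin n → (H →L[ℂ] H)} (heN : ∀ i, e i ∈ N) (hep : ∀ i, e i * p = e i)
    (hee : ∀ i j, star (e i) * e j = if i = j then p else 0) (hone : ∑ i, e i * star (e i) = 1) :
    (∀ x ∈ N, ∃ c : Fin n → Fin n → ℂ, x = ∑ i, ∑ j, c i j • (e i * star (e j))) ∧
      Module.finrank ℂ N.toStarSubalgebra = n ^ 2 := by
  have hpe : ∀ i, p * star (e i) = star (e i) := fun i => by
    rw [← hps, ← star_mul, hep]
  have hspan : ∀ x ∈ N, ∃ c : Fin n → Fin n → ℂ, x = ∑ i, ∑ j, c i j • (e i * star (e j)) := by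
    intro x hx
    have hc : ∀ i j, ∃ c : ℂ, star (e i) * x * e j = c • p := by
      intro i j
      obtain ⟨c, hc⟩ := hcorner _ (mul_mem (mul_mem (star_mem (heN i)) hx) (heN j))
      refine ⟨c, ?_⟩
      rw [← hc, mul_assoc p _ p, mul_assoc _ (e j) p, hep, ← mul_assoc p, ← mul_assoc p, hpe]
    choose c hc using hc
    refine ⟨c, ?_⟩
    calc x = (∑ i, e i * star (e i)) * x * ∑ j, e j * star (e j) := by rw [hone, one_mul, mul_one]
      _ = ∑ i, ∑ j, e i * (star (e i) * x * e j) * star (e j) := by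
          simp only [Finset.sum_mul, Finset.mul_sum, mul_assoc]
          exact Finset.sum_comm
      _ = _ := by
          simp only [hc, mul_smul_comm, smul_mul_assoc, hep]
  refine ⟨hspan, ?_⟩
  let L : Matrix (Fin n) (Fin n) ℂ →ₗ[ℂ] N.toStarSubalgebra :=
    { toFun := fun A => ⟨∑ i, ∑ j, A i j • (e i * star (e j)), sum_mem fun i _ => sum_mem fun j _ =>
        N.smul_mem _ (mul_mem (heN i) (star_mem (heN j)))⟩
      map_add' := fun A B => Subtype.ext (by simp [add_smul, Finset.sum_add_distrib])
      map_smul' := fun c A => Subtype.ext (by simp [mul_smul, Finset.smul_sum]) }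
  have hinj : Function.Injective L := by
    rw [← LinearMap.ker_eq_bot, LinearMap.ker_eq_bot']
    intro A hA
    have hA' : ∑ i, ∑ j, A i j • (e i * star (e j)) = 0 := congrArg Subtype.val hA
    ext k l
    -- Compression between `star (e k)` and `e l` isolates one coefficient.
    have h1 : star (e k) * (∑ i, ∑ j, A i j • (e i * star (e j))) * e l = A k l • p := by
      have h2 : ∀ i j, star (e k) * (A i j • (e i * star (e j))) * e l =
          if k = i then (if j = l then A i j • p else 0) else 0 := by
        intro i j
        rw [mul_smul_comm, smul_mul_assoc, ← mul_assoc, mul_assoc, hee, hee]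
        have hpp : p * p = p := by
          have := hee k k
          rw [if_pos rfl] at this
          nth_rewrite 1 [← this]
          rw [mul_assoc, hep, this]
        split_ifs <;> simp [hpp]
      simp only [Finset.mul_sum, Finset.sum_mul, h2]
      simp
    rw [hA', mul_zero, zero_mul] at h1
    exact (smul_eq_zero.1 h1.symm).resolve_right hp0
  have hsurj : Function.Surjective L := by
    rintro ⟨x, hx⟩
    obtain ⟨c, hc⟩ := hspan x hx
    exact ⟨c, Subtype.ext hc.symm⟩
  rw [← (LinearEquiv.ofBijective L ⟨hinj, hsurj⟩).finrank_eq, Module.finrank_matrix]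
  simp [sq]

namespace CodeRenormalizationScheme

variable {Λ : Type*} [PartialOrder Λ] (C : CodeRenormalizationScheme Λ H) (l : Λ)

/-- The map `a ↦ a Ω` on `M_l`. -/
def orbitMap : (C.sub l).toStarSubalgebra →ₗ[ℂ] H where
  toFun x := (x : H →L[ℂ] H) C.Ω
  map_add' _ _ := rfl
  map_smul' _ _ := rfl

theorem orbitMap_injective : Function.Injective (C.orbitMap l) := by
  rw [← LinearMap.ker_eq_bot, LinearMap.ker_eq_bot']
  exact fun x hx => Subtype.ext (C.separating _ (C.sub_le l x.2) hx)

variable [FiniteDimensional ℂ (C.sub l).toStarSubalgebra]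

theorem codeSubspace_eq_range : C.codeSubspace l = LinearMap.range (C.orbitMap l) := by
  have h : Submodule.span ℂ ((fun a : H →L[ℂ] H => a C.Ω) '' (C.sub l : Set (H →L[ℂ] H))) =
      LinearMap.range (C.orbitMap l) := by
    refine le_antisymm (Submodule.span_le.2 ?_) ?_
    · rintro _ ⟨a, ha, rfl⟩
      exact ⟨⟨a, ha⟩, rfl⟩
    · rintro _ ⟨a, rfl⟩
      exact Submodule.subset_span ⟨a, a.2, rfl⟩
  rw [codeSubspace, cyclicSubspace, h]
  exact (Submodule.closed_of_finiteDimensional _).submodule_topologicalClosure_eq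

instance finiteDimensional_codeSubspace : FiniteDimensional ℂ (C.codeSubspace l) := by
  rw [codeSubspace_eq_range]
  infer_instance

theorem finrank_codeSubspace :
    Module.finrank ℂ (C.codeSubspace l) = Module.finrank ℂ (C.sub l).toStarSubalgebra := by
  rw [codeSubspace_eq_range]
  exact LinearMap.finrank_range_of_inj (C.orbitMap_injective l)

theorem apply_mem_codeSubspace {a : H →L[ℂ] H} (ha : a ∈ C.sub l) {x : H}
    (hx : x ∈ C.codeSubspace l) : a x ∈ C.codeSubspace l := by
  rw [codeSubspace_eq_range] at hx ⊢
  obtain ⟨b, rfl⟩ := hx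
  exact ⟨⟨a, ha⟩ * b, rfl⟩

/-- The vectors `e i ξ`, with `ξ` in the multiplicity space `p H_l`, split `H_l` as `ℂ^n ⊗ p H_l`,
with `M_l` acting on the first factor. Counting `dim M_l = n²` gives `n = d`, and `dim H_l = dim
M_l` gives `dim p H_l = d`. -/
theorem nonempty_factorization (d : ℕ)
    (hdim : Module.finrank ℂ (C.sub l).toStarSubalgebra = d ^ 2) :
    Nonempty (C.Factorization l d) := by
  obtain ⟨hfac, p, hpN, hp, hp0, hmin⟩ := C.sub_typeI l
  obtain ⟨n, e, heN, hep, hee, hone⟩ := exists_matrixUnits _ hfac hpN hp hp0 hmin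
  have hps : star p = p := hp.isSelfAdjoint.star_eq
  obtain ⟨hspan, hn⟩ := finrank_eq_sq_of_matrixUnits _ hp0
    (fun x hx => exists_corner_eq_smul _ hpN hp hmin hx) hps heN hep hee hone
  obtain rfl : n = d := by
    rw [hdim] at hn
    exact (Nat.pow_left_injective two_ne_zero hn).symm
  have hpe : ∀ i, p * star (e i) = star (e i) := fun i => by
    rw [← hps, ← star_mul, hep]
  have hn0 : n ≠ 0 := by
    rintro rfl
    simp only [Finset.univ_eq_empty, Finset.sum_empty] at hone
    have h1 := C.norm_Ω
    rw [show C.Ω = (1 : H →L[ℂ] H) C.Ω from rfl, ← hone] at h1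
    simp at h1
  let P : Submodule ℂ H := C.codeSubspace l ⊓ LinearMap.eqLocus p.toLinearMap LinearMap.id
  have : FiniteDimensional ℂ P := Submodule.finiteDimensional_inf_left _ _
  let f := stdOrthonormalBasis ℂ P
  set m := Module.finrank ℂ P
  have hfp : ∀ k, p (f k : H) = f k := fun k => (f k).2.2
  have happ : ∀ i j k, star (e i) (e j (f k : H)) = if i = j then (f k : H) else 0 := by
    intro i j k
    rw [← mul_apply_eq_comp, hee]
    split_ifs <;> simp [hfp]
  let v : Fin n × Fin m → C.codeSubspace l := fun x =>
    ⟨e x.1 (f x.2 : H), C.apply_mem_codeSubspace l (heN _) (f x.2).2.1⟩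
  have hv : Orthonormal ℂ v := by
    rw [orthonormal_iff_ite]
    rintro ⟨i, k⟩ ⟨j, q⟩
    change inner ℂ (e i (f k : H)) (e j (f q : H)) = _
    rw [← ContinuousLinearMap.adjoint_inner_right, ← ContinuousLinearMap.star_eq_adjoint, happ]
    by_cases hij : i = j
    · rw [if_pos hij, ← Submodule.coe_inner, orthonormal_iff_ite.mp f.orthonormal]
      simp [hij]
    · simp [hij]
  have hvspan : ⊤ ≤ Submodule.span ℂ (Set.range v) := by
    rintro ⟨x, hx⟩ -
    have h1 : ∀ i, star (e i) x ∈ P := fun i =>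
      ⟨C.apply_mem_codeSubspace l (star_mem (heN i)) hx, by
        change p (star (e i) x) = star (e i) x
        rw [← mul_apply_eq_comp, hpe]⟩
    have h2 : (⟨x, hx⟩ : C.codeSubspace l) =
        ∑ i, ∑ k, (inner ℂ (f k) (⟨star (e i) x, h1 i⟩ : P) : ℂ) • v (i, k) := by
      apply Subtype.ext
      calc x = ∑ i, e i (star (e i) x) := by
            have := congrArg (fun T : H →L[ℂ] H => T x) hone
            simpa [sum_apply] using this.symm
        _ = _ := by
            rw [Submodule.coe_sum]
            refine Finset.sum_congr rfl fun i _ => ?_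
            have h3 := congrArg Subtype.val (f.sum_repr' ⟨star (e i) x, h1 i⟩)
            simp only [Submodule.coe_sum, Submodule.coe_smul] at h3 ⊢
            refine (congrArg (e i) h3).symm.trans ?_
            rw [map_sum]
            exact Finset.sum_congr rfl fun k _ => map_smul _ _ _
    rw [h2]
    exact sum_mem fun i _ => sum_mem fun k _ => Submodule.smul_mem _ _ (Submodule.subset_span ⟨_, rfl⟩)
  let b := OrthonormalBasis.mk hv hvspan
  have hm : m = n := by
    have h1 := Module.finrank_eq_card_basis b.toBasis
    rw [finrank_codeSubspace, hdim, Fintype.card_prod, Fintype.card_fin, Fintype.card_fin, sq] at h1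
    exact (Nat.eq_of_mul_eq_mul_left (Nat.pos_of_ne_zero hn0) h1).symm
  let ε := EuclideanSpace.basisFun (Fin n) ℂ
  let J := b.equiv (ε.tensorProduct ε) (Equiv.prodCongr (Equiv.refl _) (finCongr hm))
  have hJ : ∀ i k, J (v (i, k)) = ε i ⊗ₜ[ℂ] ε (finCongr hm k) := by
    intro i k
    have : v (i, k) = b (i, k) := by simp [b]
    rw [this, OrthonormalBasis.equiv_apply_basis]
    simp
  -- Coefficients in the matrix units are the matrix entries on the first factor; this serves both
  -- directions of the characterization of the left algebra.
  have hmat : ∀ (c : Fin n → Fin n → ℂ) (x y : C.codeSubspace l),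
      (y : H) = (∑ i, ∑ j, c i j • (e i * star (e j))) (x : H) →
      J y = LinearMap.rTensor _ (ε.toBasis.constr ℂ fun j => ∑ i, c i j • ε i) (J x) := by
    intro c x y hxy
    set a := ∑ i, ∑ j, c i j • (e i * star (e j)) with ha
    have haN : a ∈ C.sub l := sum_mem fun i _ => sum_mem fun j _ =>
      VonNeumannAlgebra.smul_mem _ _ (mul_mem (heN i) (star_mem (heN j)))
    let S : C.codeSubspace l →ₗ[ℂ] C.codeSubspace l :=
      a.toLinearMap.restrict fun x hx => C.apply_mem_codeSubspace l haN hx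
    have hS : J.toLinearEquiv.toLinearMap ∘ₗ S =
        LinearMap.rTensor _ (ε.toBasis.constr ℂ fun j => ∑ i, c i j • ε i) ∘ₗ
          J.toLinearEquiv.toLinearMap := by
      refine b.toBasis.ext fun ⟨j, k⟩ => ?_
      have hbv : b.toBasis (j, k) = v (j, k) := by simp [b]
      have hSv : S (v (j, k)) = ∑ i, c i j • v (i, k) := by
        apply Subtype.ext
        change a (e j (f k : H)) = _
        rw [ha, Submodule.coe_sum]
        simp only [sum_apply, smul_apply, mul_apply_eq_comp, happ, Submodule.coe_smul]
        refine Finset.sum_congr rfl fun i _ => ?_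
        rw [Finset.sum_eq_single j]
        · simp [v]
        · intro j' _ hj'
          simp [hj']
        · simp
      have hεj := ε.toBasis.constr_basis ℂ (fun j => ∑ i, c i j • ε i) j
      rw [OrthonormalBasis.coe_toBasis] at hεj
      rw [hbv]
      change J (S (v (j, k))) = LinearMap.rTensor _ _ (J (v (j, k)))
      rw [hSv, map_sum, hJ, LinearMap.rTensor_tmul, hεj, TensorProduct.sum_tmul]
      refine Finset.sum_congr rfl fun i _ => ?_
      rw [map_smul, hJ, TensorProduct.smul_tmul']
    have hy : y = S x := Subtype.ext hxy
    rw [hy]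
    exact LinearMap.congr_fun hS x
  refine ⟨⟨J, fun T => ⟨?_, ?_⟩⟩⟩
  · rintro ⟨a, ha, haT⟩
    obtain ⟨c, hc⟩ := hspan a ha
    exact ⟨_, fun x => hmat c x (T x) (hc ▸ haT x)⟩
  · rintro ⟨A, hA⟩
    have hAc : A = ε.toBasis.constr ℂ fun j => ∑ i, (inner ℂ (ε i) (A (ε j)) : ℂ) • ε i := by
      refine ε.toBasis.ext fun j => ?_
      rw [Module.Basis.constr_basis, OrthonormalBasis.coe_toBasis, ε.sum_repr']
    have haN : ∑ i, ∑ j, (inner ℂ (ε i) (A (ε j)) : ℂ) • (e i * star (e j)) ∈ C.sub l :=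
      sum_mem fun i _ => sum_mem fun j _ =>
        VonNeumannAlgebra.smul_mem _ _ (mul_mem (heN i) (star_mem (heN j)))
    refine ⟨_, haN, fun x => ?_⟩
    have h1 := hmat (fun i j => inner ℂ (ε i) (A (ε j))) x
      ⟨_, C.apply_mem_codeSubspace l haN x.2⟩ rfl
    rw [← hAc, ← hA] at h1
    exact (congrArg Subtype.val (J.injective h1)).symm

end CodeRenormalizationScheme

end Factor

/-! ### Transfer to the scheme and the large-`N` limit -/

section Main

namespace CodeRenormalizationScheme

variable {H : Type*} [NormedAddCommGroup H] [InnerProductSpace ℂ H] [CompleteSpace H]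
  {Λ : Type*} [PartialOrder Λ] {C : CodeRenormalizationScheme Λ H} {l : Λ}

/-- The isometric automorphism of `H_l` that corresponds to `U ⊗ 1`. -/
def Factorization.leftIsometry {d : ℕ} (F : C.Factorization l d)
    (U : EuclideanSpace ℂ (Fin d) ≃ₗᵢ[ℂ] EuclideanSpace ℂ (Fin d)) :
    C.codeSubspace l ≃ₗᵢ[ℂ] C.codeSubspace l :=
  F.toIso.trans ((U.rTensor (G := EuclideanSpace ℂ (Fin d))).trans F.toIso.symm)

/-- The isometric automorphism of `H_l` that corresponds to `1 ⊗ U`. -/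
def Factorization.rightIsometry {d : ℕ} (F : C.Factorization l d)
    (U : EuclideanSpace ℂ (Fin d) ≃ₗᵢ[ℂ] EuclideanSpace ℂ (Fin d)) :
    C.codeSubspace l ≃ₗᵢ[ℂ] C.codeSubspace l :=
  F.toIso.trans ((U.lTensor (E := EuclideanSpace ℂ (Fin d))).trans F.toIso.symm)

theorem Factorization.toIso_leftIsometry {d : ℕ} (F : C.Factorization l d)
    (U : EuclideanSpace ℂ (Fin d) ≃ₗᵢ[ℂ] EuclideanSpace ℂ (Fin d)) (x : C.codeSubspace l) :
    F.toIso (F.leftIsometry U x) = LinearMap.rTensor _ U.toLinearEquiv.toLinearMap (F.toIso x) :=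
  F.toIso.apply_symm_apply _

theorem Factorization.toIso_rightIsometry {d : ℕ} (F : C.Factorization l d)
    (U : EuclideanSpace ℂ (Fin d) ≃ₗᵢ[ℂ] EuclideanSpace ℂ (Fin d)) (x : C.codeSubspace l) :
    F.toIso (F.rightIsometry U x) = LinearMap.lTensor _ U.toLinearEquiv.toLinearMap (F.toIso x) :=
  F.toIso.apply_symm_apply _

/-- The unitary of `M_l^L` that corresponds to `U ⊗ 1`. -/
def Factorization.leftUnitary {d : ℕ} (F : C.Factorization l d)
    (U : EuclideanSpace ℂ (Fin d) ≃ₗᵢ[ℂ] EuclideanSpace ℂ (Fin d)) : C.LeftUnitary l :=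
  ⟨Unitary.linearIsometryEquiv.symm (F.leftIsometry U), (Unitary.linearIsometryEquiv.symm _).2,
    (F.left_iff _).2 ⟨U.toLinearEquiv.toLinearMap, F.toIso_leftIsometry U⟩⟩

/-- The unitary of `M_l^R` that corresponds to `1 ⊗ U`. -/
def Factorization.rightUnitary {d : ℕ} (F : C.Factorization l d)
    (U : EuclideanSpace ℂ (Fin d) ≃ₗᵢ[ℂ] EuclideanSpace ℂ (Fin d)) : C.RightUnitary l :=
  ⟨Unitary.linearIsometryEquiv.symm (F.rightIsometry U), (Unitary.linearIsometryEquiv.symm _).2, by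
    intro T hT
    obtain ⟨A, hA⟩ := (F.left_iff T).1 hT
    ext x
    congr 1
    apply F.toIso.injective
    change F.toIso (T (F.rightIsometry U x)) = F.toIso (F.rightIsometry U (T x))
    rw [hA, F.toIso_rightIsometry, F.toIso_rightIsometry, hA, ← LinearMap.comp_apply,
      ← LinearMap.comp_apply, LinearMap.rTensor_comp_lTensor, LinearMap.lTensor_comp_rTensor]⟩

theorem Factorization.toIso_rightUnitary_leftUnitary {d : ℕ} (F : C.Factorization l d)
    (U U' : EuclideanSpace ℂ (Fin d) ≃ₗᵢ[ℂ] EuclideanSpace ℂ (Fin d)) (x : C.codeSubspace l) :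
    F.toIso ((F.rightUnitary U').1 ((F.leftUnitary U).1 x)) =
      TensorProduct.map U.toLinearEquiv.toLinearMap U'.toLinearEquiv.toLinearMap (F.toIso x) := by
  refine (F.toIso_rightIsometry U' (F.leftIsometry U x)).trans ?_
  rw [F.toIso_leftIsometry, ← LinearMap.comp_apply, LinearMap.lTensor_comp_rTensor]

/-- The fixed-size formula is applied to `V` read through the factorization, with `V (VR VL Ψ)` as
reference vector. Unitaries `U ⊗ 1` and `1 ⊗ U'` lie in the left and right algebras, so
reconstruction covers them. -/
theorem Factorization.abs_bulkEntropy_add_area_sub_le {d : ℕ} [NeZero d] (F : C.Factorization l d)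
    {K : Type*} [NormedAddCommGroup K] [InnerProductSpace ℂ K] [CompleteSpace K]
    [FiniteDimensional ℂ K] (V : H →L[ℂ] K ⊗[ℂ] K) (hV : ‖V‖ ≤ 1) (Ψ : C.codeSubspace l)
    (hΨ : ‖Ψ‖ = 1) (VL : C.LeftUnitary l) (VR : C.RightUnitary l) (δ : ℝ)
    (hδ : 2 * (d ^ 2 * δ) ≤ 1)
    (tL : C.LeftUnitary l → unitary (K →L[ℂ] K)) (tR : C.RightUnitary l → unitary (K →L[ℂ] K))
    (h : ∀ (UL : C.LeftUnitary l) (UR : C.RightUnitary l),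
      ‖V (UR.1 (UL.1 Ψ)) - TensorProduct.map (tL UL : K →L[ℂ] K).toLinearMap
        (tR UR : K →L[ℂ] K).toLinearMap (V (VR.1 (VL.1 Ψ)))‖ ≤ δ) :
    |F.bulkEntropy Ψ + F.area V - leftEntropy (V (VR.1 (VL.1 Ψ)))| ≤
      2 * (d ^ 2 * δ) * Real.log (Module.finrank ℂ K * d * d) + Real.negMulLog (2 * (d ^ 2 * δ)) +
        2 * (2 * (d ^ 2 * δ)) + 2 * (1 - ‖V Ψ‖ + δ + d ^ 2 * δ) * d := by
  have hVx : ∀ x : H, ‖V x‖ ≤ ‖x‖ := fun x => by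
    simpa using V.le_of_opNorm_le hV x
  let W := V.toLinearMap ∘ₗ (C.codeSubspace l).subtype ∘ₗ F.toIso.symm.toLinearEquiv.toLinearMap
  have hWF : ∀ x : C.codeSubspace l, W (F.toIso x) = V x := fun x => by
    change V (F.toIso.symm (F.toIso x) : C.codeSubspace l) = V x
    rw [F.toIso.symm_apply_apply]
  have key := abs_leftEntropy_add_areaTerm_sub_le W
    (fun x => (hVx _).trans_eq (F.toIso.symm.norm_map x)) (F.toIso Ψ)
    ((F.toIso.norm_map Ψ).trans hΨ) (V (VR.1 (VL.1 Ψ))) (by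
      refine (hVx _).trans_eq ?_
      change ‖VR.1 (VL.1 Ψ)‖ = 1
      rw [ContinuousLinearMap.norm_map_of_mem_unitary VR.2.1,
        ContinuousLinearMap.norm_map_of_mem_unitary VL.2.1, hΨ]) δ hδ
    (fun U => (Unitary.linearIsometryEquiv (tL (F.leftUnitary U))).toLinearIsometry)
    (fun U => (Unitary.linearIsometryEquiv (tR (F.rightUnitary U))).toLinearIsometry)
    (fun U U' => by
      rw [← F.toIso_rightUnitary_leftUnitary, hWF]
      exact h _ _)
  rw [hWF] at key
  exact key

end CodeRenormalizationScheme

/-- With `d` fixed, the only growing factor is the polynomial, and it multiplies `δ`;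
superpolynomial decay kills that product. -/
theorem tendsto_fannes_bound (d : ℕ) (P : Polynomial ℝ) (δ : ℕ → ℝ)
    (hδ : Asymptotics.SuperpolynomialDecay atTop (fun N : ℕ => (N : ℝ)) δ) (n : ℕ → ℝ)
    (hn : Tendsto n atTop (𝓝 1)) :
    Tendsto (fun N => 2 * (d ^ 2 * δ N) * (P.eval (N : ℝ) + 2 * Real.log d) +
      Real.negMulLog (2 * (d ^ 2 * δ N)) + 2 * (2 * (d ^ 2 * δ N)) +
        2 * (1 - n N + δ N + d ^ 2 * δ N) * d) atTop (𝓝 0) := by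
  have h0 : Tendsto δ atTop (𝓝 0) := by simpa using hδ 0
  have h1 : Tendsto (fun N : ℕ => P.eval (N : ℝ) * δ N) atTop (𝓝 0) := by
    simpa using hδ.polynomial_mul P 0
  have h2 : Tendsto (fun N => 2 * (d ^ 2 * δ N)) atTop (𝓝 0) := by
    simpa using (h0.const_mul ((d : ℝ) ^ 2)).const_mul 2
  have h3 : Tendsto (fun N => Real.negMulLog (2 * (d ^ 2 * δ N))) atTop (𝓝 0) := by
    have := (Real.continuous_negMulLog.tendsto 0).comp h2
    rwa [Real.negMulLog_zero] at this
  have h4 : Tendsto (fun N => 2 * (d ^ 2 * δ N) * (P.eval (N : ℝ) + 2 * Real.log d)) atTop (𝓝 0) := by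
    have := (h1.const_mul (2 * (d : ℝ) ^ 2)).add (h2.mul_const (2 * Real.log d))
    simp only [mul_zero, zero_mul, add_zero] at this
    refine this.congr fun N => ?_
    ring
  have h5 := (((hn.const_sub 1).add h0).add (h0.const_mul ((d : ℝ) ^ 2))).const_mul 2 |>.mul_const
    (d : ℝ)
  have h6 := ((h4.add h3).add (h2.const_mul 2)).add h5
  simpa using h6

end Main

end

theorem mainTheorem2 {Λ : Type*} [PartialOrder Λ]
    {𝓗 : ℕ → Type*} [∀ N, NormedAddCommGroup (𝓗 N)] [∀ N, InnerProductSpace ℂ (𝓗 N)]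
    [∀ N, CompleteSpace (𝓗 N)]
    {K : ℕ → Type*} [∀ N, NormedAddCommGroup (K N)] [∀ N, InnerProductSpace ℂ (K N)]
    [∀ N, CompleteSpace (K N)] [∀ N, FiniteDimensional ℂ (K N)]
    (C : LargeNCode Λ 𝓗 K) (l : Λ)
    -- `M_l` has fixed finite dimension `d ^ 2`
    (d : ℕ) (hfin : ∀ N, FiniteDimensional ℂ ((C.scheme N).sub l).toStarSubalgebra)
    (hdim : ∀ N, Module.finrank ℂ ((C.scheme N).sub l).toStarSubalgebra = d ^ 2)
    -- the logarithm of the boundary dimension is polynomially bounded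
    (P : Polynomial ℝ) (hP : ∀ N : ℕ, Real.log (Module.finrank ℂ (K N)) ≤ P.eval (N : ℝ))
    -- a normalized state in the regulated code subspace, asymptotically isometrically encoded
    (Ψ : ∀ N, (C.scheme N).codeSubspace l) (hΨ : ∀ N, ‖Ψ N‖ = 1)
    (hiso : Tendsto (fun N => ‖C.V N (Ψ N)‖) atTop (𝓝 1))
    -- reconstruction of product unitaries, with error decaying faster than any polynomial
    (δ : ℕ → ℝ) (hδ : Asymptotics.SuperpolynomialDecay atTop (fun N : ℕ => (N : ℝ)) δ)
    (hrec : ∀ (N : ℕ) (VL : (C.scheme N).LeftUnitary l) (VR : (C.scheme N).RightUnitary l),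
      ∃ (tL : (C.scheme N).LeftUnitary l → unitary (K N →L[ℂ] K N))
        (tR : (C.scheme N).RightUnitary l → unitary (K N →L[ℂ] K N)),
        Measurable tL ∧ Measurable tR ∧
        ∀ (UL : (C.scheme N).LeftUnitary l) (UR : (C.scheme N).RightUnitary l),
          ‖C.V N (UR.1 (UL.1 (Ψ N))) -
            TensorProduct.map (tL UL : K N →L[ℂ] K N).toLinearMap
              (tR UR : K N →L[ℂ] K N).toLinearMap (C.V N (VR.1 (VL.1 (Ψ N))))‖ ≤ δ N) :
    (∀ N, Nonempty ((C.scheme N).Factorization l d)) ∧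
    ∀ (F : ∀ N, (C.scheme N).Factorization l d)
      (VL : ∀ N, (C.scheme N).LeftUnitary l) (VR : ∀ N, (C.scheme N).RightUnitary l),
      Tendsto (fun N => |(F N).bulkEntropy (Ψ N) + (F N).area (C.V N) -
        leftEntropy (C.V N ((VR N).1 ((VL N).1 (Ψ N))))|) atTop (𝓝 0) := by
  refine ⟨fun N => (C.scheme N).nonempty_factorization l d (hdim N), fun F VL VR => ?_⟩
  choose tL tR _ _ hrec using fun N => hrec N (VL N) (VR N)
  have hδ0 : ∀ N, 0 ≤ δ N := fun N => (norm_nonneg _).trans (hrec N (VL N) (VR N))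
  -- For `d = 0` the code subspace would be zero and could not contain a unit vector.
  have hd : d ≠ 0 := by
    rintro rfl
    have h1 := hΨ 0
    rw [← (F 0).toIso.norm_map, Subsingleton.elim ((F 0).toIso (Ψ 0)) 0, norm_zero] at h1
    exact zero_ne_one h1
  have : NeZero d := ⟨hd⟩
  have hd1 : (1 : ℝ) ≤ d := by exact_mod_cast Nat.one_le_iff_ne_zero.2 hd
  have hlog : ∀ N, Real.log (Module.finrank ℂ (K N) * d * d) ≤ P.eval (N : ℝ) + 2 * Real.log d := by
    intro N
    have h1 := hP N
    have h2 := Real.log_nonneg hd1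
    -- A zero boundary space is covered by the convention `log 0 = 0`.
    rcases Nat.eq_zero_or_pos (Module.finrank ℂ (K N)) with h | h
    · rw [h, Nat.cast_zero, Real.log_zero] at h1
      rw [h, Nat.cast_zero, zero_mul, zero_mul, Real.log_zero]
      linarith
    · have h3 : (Module.finrank ℂ (K N) : ℝ) ≠ 0 := by exact_mod_cast h.ne'
      have h4 : (d : ℝ) ≠ 0 := by positivity
      rw [Real.log_mul (mul_ne_zero h3 h4) h4, Real.log_mul h3 h4]
      linarith
  -- The Fannes bound needs `2 d² δ ≤ 1`, which holds only eventually.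
  have hsmall : ∀ᶠ N in atTop, 2 * (d ^ 2 * δ N) ≤ 1 := by
    have h0 : Tendsto δ atTop (𝓝 0) := by simpa using hδ 0
    have h2 : Tendsto (fun N => 2 * (d ^ 2 * δ N)) atTop (𝓝 0) := by
      simpa using (h0.const_mul ((d : ℝ) ^ 2)).const_mul 2
    exact h2.eventually_le_const one_pos
  refine squeeze_zero' (Eventually.of_forall fun N => abs_nonneg _) ?_
    (tendsto_fannes_bound d P δ hδ _ hiso)
  filter_upwards [hsmall] with N hN
  refine ((F N).abs_bulkEntropy_add_area_sub_le (C.V N) (C.contractive N) (Ψ N) (hΨ N) (VL N) (VR N)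
    (δ N) hN (tL N) (tR N) (hrec N)).trans ?_
  have h5 : 0 ≤ 2 * ((d : ℝ) ^ 2 * δ N) := by have := hδ0 N; positivity
  have := mul_le_mul_of_nonneg_left (hlog N) h5
  linarith
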